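/- Let $d\ge 2$. A $(d-1)$-dimensional simplicial complex is *balanced* if its vertices are colored with $d$ colors so that no face contains two vertices of the same color. A *balanced connected sum* of two pure balanced $(d-1)$-dimensional complexes on disjoint vertex sets identifies the vertices of a facet of the first with those of a facet of the second by a color-preserving bijection and removes the resulting common face. A *balanced handle addition* to one pure balanced complex does the same with two disjoint facets $F,F'$ and a color-preserving bijection $\varphi:F\to F'$ such that, for each $v\in F$, the vertices $v$ and $\varphi(v)$ have no common neighbor. Let $\Delta_1,\Delta_2,\Delta_3$ be boundary complexes of $d$-dimensional cross-polytopes with vertex sets $\{x_i,y_i\}_{i=1}^d$, $\{y'_i,z_i\}_{i=1}^d$ and $\{z'_i,x'_i\}_{i=1}^d$ respectively, where the vertices with index $i$ are the two antipodal vertices of color $i$. Identifying $y_i$ with $y'_i$ for all $i$ gives a balanced connected sum $\Delta_1\#\Delta_2$; identifying $z_i$ with $z'_i$ for all $i$ gives a balanced connected sum $\widetilde\Delta=(\Delta_1\#\Delta_2)\#\Delta_3$; and identifying $x_i$ with $x'_i$ for all $i$ is a balanced handle addition to $\widetilde\Delta$. The resulting complex $BM_d$ is a balanced simplicial manifold of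 dimension $d-1$ with exactly $3d$ vertices (that is, its geometric realization is a topological $(d-1)$-manifold without boundary). Its geometric realization is homeomorphic to $\mathbb{S}^{d-2}\times\mathbb{S}^1$ if $d$ is odd, and to the nonorientable $\mathbb{S}^{d-2}$-bundle over $\mathbb{S}^1$ if $d$ is even, i.e. to the quotient of $\mathbb{S}^{d-2}\times[0,1]$ by $(x,0)\sim(r(x),1)$, where $r$ is the reflection of $\mathbb{S}^{d-2}\subset\mathbb{R}^{d-1}$ that changes the sign of the first coordinate. -/

import Mathlib

namespace BalancedManifold

/-! ### Simplicial complexes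

A complex is given by its nonempty faces, which are finite sets in an ambient type `V`; its vertices
are the `v : V` such that `{v}` is a face. -/

section Complexes

variable {V W : Type*}

/-- The vertex set of a complex. -/
def vertices (K : PreAbstractSimplicialComplex V) : Set V := {v | {v} ∈ K}

/-- A facet is a face that is maximal under inclusion. -/
def IsFacet (K : PreAbstractSimplicialComplex V) (s : Finset V) : Prop := Maximal (· ∈ K) s

/-- All facets have dimension `d - 1`, that is, `d` vertices. -/
def IsPure (d : ℕ) (K : PreAbstractSimplicialComplex V) : Prop := ∀ s, IsFacet K s → s.card = d

/-- Two distinct vertices are neighbors if they span an edge. -/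
def IsNeighbor [DecidableEq V] (K : PreAbstractSimplicialComplex V) (u v : V) : Prop :=
  u ≠ v ∧ ({u, v} : Finset V) ∈ K

/-- `K` has dimension `d - 1`, and `κ` is a coloring with `d` colors such that no face contains two
vertices of the same color. -/
structure IsBalanced (d : ℕ) (K : PreAbstractSimplicialComplex V) (κ : V → Fin d) : Prop where
  card_le : ∀ s ∈ K, s.card ≤ d
  exists_card_eq : ∃ s ∈ K, s.card = d
  injOn_color : ∀ s ∈ K, Set.InjOn κ s

/-- The complex obtained by removing all faces that contain `F`; if `F` is a facet, this removes
exactly the face `F`. -/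
def removeFace (K : PreAbstractSimplicialComplex V) (F : Finset V) :
    PreAbstractSimplicialComplex V where
  faces := {s | s ∈ K ∧ ¬ F ⊆ s}
  isRelLowerSet_faces := by
    rintro s ⟨hs, hF⟩
    exact ⟨(K.isRelLowerSet_faces hs).1, fun t hts ht =>
      ⟨(K.isRelLowerSet_faces hs).2 hts ht, fun h => hF (h.trans hts)⟩⟩

variable [DecidableEq V] [DecidableEq W]

/-- The connected sum of `Γ` and `Δ` along `φ : F → φ(F)`: in the disjoint union, every vertex `v`
of `F` is identified with the vertex `φ v` of `Δ` (which represents the identified pair), and the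
face on the identified vertices is removed. -/
def connectedSum (Γ : PreAbstractSimplicialComplex V) (Δ : PreAbstractSimplicialComplex W)
    (F : Finset V) (φ : V → W) : PreAbstractSimplicialComplex (V ⊕ W) :=
  removeFace
    (Γ.map (fun v => if v ∈ F then Sum.inr (φ v) else Sum.inl v) ⊔ Δ.map Sum.inr)
    (F.image (fun v => Sum.inr (φ v)))

/-- The conditions under which `connectedSum Γ Δ F φ` is a balanced connected sum of
`(d - 1)`-dimensional complexes colored by `κ` and `κ'`. -/
structure IsBalancedConnectedSum (d : ℕ) (Γ : PreAbstractSimplicialComplex V) (κ : V → Fin d)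
    (Δ : PreAbstractSimplicialComplex W) (κ' : W → Fin d) (F : Finset V) (φ : V → W) : Prop where
  balanced_left : IsBalanced d Γ κ
  balanced_right : IsBalanced d Δ κ'
  pure_left : IsPure d Γ
  pure_right : IsPure d Δ
  facet_left : IsFacet Γ F
  facet_right : IsFacet Δ (F.image φ)
  injOn : Set.InjOn φ F
  color : ∀ v ∈ F, κ' (φ v) = κ v

/-- The handle addition to `Δ` along `φ : F → φ(F)`: every vertex `v` of `F` is identified with the
vertex `φ v` (which represents the identified pair), and the face on the identified vertices is
removed. -/
def handleAddition (Δ : PreAbstractSimplicialComplex V) (F : Finset V) (φ : V → V) :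
    PreAbstractSimplicialComplex V :=
  removeFace (Δ.map (fun v => if v ∈ F then φ v else v)) (F.image φ)

/-- The conditions under which `handleAddition Δ F φ` is a balanced handle addition to the
`(d - 1)`-dimensional complex `Δ` colored by `κ`. -/
structure IsBalancedHandleAddition (d : ℕ) (Δ : PreAbstractSimplicialComplex V) (κ : V → Fin d)
    (F : Finset V) (φ : V → V) : Prop where
  balanced : IsBalanced d Δ κ
  pure : IsPure d Δ
  facet : IsFacet Δ F
  facet' : IsFacet Δ (F.image φ)
  disjoint : Disjoint F (F.image φ)
  injOn : Set.InjOn φ F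
  color : ∀ v ∈ F, κ (φ v) = κ v
  no_common_neighbor : ∀ v ∈ F, ∀ u, ¬ (IsNeighbor Δ v u ∧ IsNeighbor Δ (φ v) u)

/-- The geometric realization of a complex on a finite vertex set, in barycentric coordinates, with
the topology of a subspace of `ℝ^V`. -/
def realization [Fintype V] (K : PreAbstractSimplicialComplex V) : Set (V → ℝ) :=
  {w | w ∈ stdSimplex ℝ V ∧ ∃ s ∈ K, ∀ v, v ∉ s → w v = 0}

end Complexes

/-! ### Manifolds and sphere bundles over the circle -/

/-- `X` is a topological manifold (without boundary) of dimension `n`. -/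
structure IsTopologicalManifold (n : ℕ) (X : Type*) [TopologicalSpace X] : Prop where
  t2 : T2Space X
  secondCountable : SecondCountableTopology X
  locallyEuclidean : Nonempty (ChartedSpace (EuclideanSpace ℝ (Fin n)) X)

/-- `K` is a simplicial manifold of dimension `n`. -/
def IsSimplicialManifold {V : Type*} [Fintype V] (n : ℕ) (K : PreAbstractSimplicialComplex V) :
    Prop :=
  IsTopologicalManifold n (realization K)

/-- The unit sphere `S^n` in `ℝ^{n+1}`. -/
abbrev UnitSphere (n : ℕ) : Type := Metric.sphere (0 : EuclideanSpace ℝ (Fin (n + 1))) 1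

/-- The nonorientable `S^n`-bundle over `S^1`: the mapping torus of the reflection of `S^n` in the
first coordinate, that is, the quotient of `S^n × [0, 1]` that identifies `(x, 0)` with
`(r x, 1)`, where `r` changes the sign of the first coordinate. -/
abbrev NonorientableSphereBundle (n : ℕ) : Type :=
  Quot (fun p q : UnitSphere n × unitInterval =>
    p.2 = 0 ∧ q.2 = 1 ∧
      ∀ i : Fin (n + 1), q.1.1 i = if i = 0 then - p.1.1 i else p.1.1 i)

/-! ### The complex `BM d` -/

/-- The boundary complex of the `d`-dimensional cross-polytope, with the two vertices `(i, false)`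
and `(i, true)` of each color `i`: a nonempty set is a face if it contains at most one of the two
for each `i`. -/
def crossPolytope (d : ℕ) : PreAbstractSimplicialComplex (Fin d × Bool) where
  faces := {s | s.Nonempty ∧ ∀ i, ¬ ((i, false) ∈ s ∧ (i, true) ∈ s)}
  isRelLowerSet_faces := by
    rintro s ⟨hs, h⟩
    exact ⟨hs, fun t hts ht => ⟨ht, fun i hi => h i ⟨hts hi.1, hts hi.2⟩⟩⟩

/-- The vertices of the sum of two cross-polytopes. -/
abbrev Vert₂ (d : ℕ) : Type := (Fin d × Bool) ⊕ (Fin d × Bool)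

/-- The vertices of the sum of three cross-polytopes. They are named
`x i = inl (inl (i, false))`, `y i = inl (inl (i, true))` (first cross-polytope),
`y' i = inl (inr (i, false))`, `z i = inl (inr (i, true))` (second cross-polytope),
`z' i = inr (i, false)`, `x' i = inr (i, true)` (third cross-polytope). -/
abbrev Vert₃ (d : ℕ) : Type := Vert₂ d ⊕ (Fin d × Bool)

/-- The vertices with index `i` have color `i`. -/
def color₁ (d : ℕ) : Fin d × Bool → Fin d := Prod.fst

/-- The vertices with index `i` have color `i`. -/
def color₂ (d : ℕ) : Vert₂ d → Fin d := Sum.elim (color₁ d) (color₁ d)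

/-- The vertices with index `i` have color `i`. -/
def color₃ (d : ℕ) : Vert₃ d → Fin d := Sum.elim (color₂ d) (color₁ d)

/-- The facet `{y 1, …, y d}` of the first cross-polytope. -/
def facetY (d : ℕ) : Finset (Fin d × Bool) := Finset.univ.image (fun i => (i, true))

/-- The identification of `y i` with `y' i`. -/
def glueY (d : ℕ) : Fin d × Bool → Fin d × Bool := fun v => (color₁ d v, false)

/-- The connected sum of the first two cross-polytopes, with `y i` identified with `y' i`. -/
def sum₂ (d : ℕ) : PreAbstractSimplicialComplex (Vert₂ d) :=
  connectedSum (crossPolytope d) (crossPolytope d) (facetY d) (glueY d)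

/-- The facet `{z 1, …, z d}` of the sum of the first two cross-polytopes. -/
def facetZ (d : ℕ) : Finset (Vert₂ d) := Finset.univ.image (fun i => Sum.inr (i, true))

/-- The identification of `z i` with `z' i`. -/
def glueZ (d : ℕ) : Vert₂ d → Fin d × Bool := fun v => (color₂ d v, false)

/-- The connected sum of the three cross-polytopes, with `z i` identified with `z' i`. -/
def sum₃ (d : ℕ) : PreAbstractSimplicialComplex (Vert₃ d) :=
  connectedSum (sum₂ d) (crossPolytope d) (facetZ d) (glueZ d)

/-- The facet `{x 1, …, x d}` of the sum of the three cross-polytopes. -/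
def facetX (d : ℕ) : Finset (Vert₃ d) :=
  Finset.univ.image (fun i => Sum.inl (Sum.inl (i, false)))

/-- The identification of `x i` with `x' i`. -/
def glueX (d : ℕ) : Vert₃ d → Vert₃ d := fun v => Sum.inr (color₃ d v, true)

/-- The complex `BM d`: a handle is added by identifying `x i` with `x' i`. -/
def BM (d : ℕ) : PreAbstractSimplicialComplex (Vert₃ d) :=
  handleAddition (sum₃ d) (facetX d) (glueX d)

end BalancedManifold

open BalancedManifold

/-! `BM d` is a cyclic union of three cross-polytope boundaries on consecutive pairs of the layers
`x`, `y`, `z`, with the layer facets removed. The boundary of a cross-polytope minus two opposite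
facets consists of the vectors `u` with `∑ |u i| = 1` having coordinates of both signs, and is a
cylinder `S^(d-2) × [0, 1]`: each `u` is determined by its class modulo positive scalings and
constants, and by its height between the two ends. The two ends of a cylinder see a layer with
opposite signs, so consecutive cylinders are glued along the antipodal map and the realization of
`BM d` is the mapping torus of `(-1) ^ 3 = -1` on the sphere `S^(d-2)`. A path of rotations that
performs a half turn in disjoint coordinate planes deforms `-1` to the identity if `d - 1` is even,
and to the reflection in the first coordinate if `d - 1` is odd. Every point lies in the interior
of a cylinder `S^(d-2) × (0, 1)` once the torus is cut at a suitable place, which gives charts. -/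

namespace BalancedManifold

section Colorings

variable {V : Type*} {d : ℕ} {κ : V → Fin d} {K : PreAbstractSimplicialComplex V}

theorem card_le_of_injOn_color {s : Finset V} (hs : Set.InjOn κ s) : s.card ≤ d := by
  classical
  simpa [Finset.card_image_of_injOn hs] using Finset.card_le_univ (s.image κ)

theorem exists_color_notMem {s : Finset V} (hs : s.card < d) : ∃ i, ∀ v ∈ s, κ v ≠ i := by
  classical
  obtain ⟨i, -, hi⟩ := Finset.exists_mem_notMem_of_card_lt_card
    (s := s.image κ) (t := Finset.univ) (by simpa using Finset.card_image_le.trans_lt hs)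
  exact ⟨i, fun v hv h => hi (Finset.mem_image.2 ⟨v, hv, h⟩)⟩

theorem isFacet_of_card_eq (hK : ∀ s ∈ K, Set.InjOn κ s) {s : Finset V} (hs : s ∈ K)
    (hc : s.card = d) : IsFacet K s :=
  ⟨hs, fun t ht hst =>
    (Finset.eq_of_subset_of_card_le hst (hc ▸ card_le_of_injOn_color (hK t ht))).ge⟩

theorem IsPure.isBalanced [Finite V] (hp : IsPure d K) (hK : ∀ s ∈ K, Set.InjOn κ s)
    {s : Finset V} (hs : s ∈ K) : IsBalanced d K κ := by
  obtain ⟨F, -, hF⟩ := (Set.toFinite {t | t ∈ K}).exists_le_maximal hs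
  exact ⟨fun t ht => card_le_of_injOn_color (hK t ht), ⟨F, hF.1, hp F hF⟩, hK⟩

end Colorings

section CrossPolytopeUnions

variable {ι ι' V W : Type*} {d : ℕ}

/-- The vertex `g k i` of the layer `k` has color `i`, and distinct layers are disjoint. -/
structure IsLayering (κ : V → Fin d) (g : ι → Fin d → V) : Prop where
  color : ∀ k i, κ (g k i) = i
  injective : ∀ i, Function.Injective (g · i)

theorem IsLayering.eq_iff {κ : V → Fin d} {g : ι → Fin d → V} (hg : IsLayering κ g) {k l : ι}
    {i j : Fin d} : g k i = g l j ↔ k = l ∧ i = j := by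
  refine ⟨fun h => ?_, fun h => h.1 ▸ h.2 ▸ rfl⟩
  obtain rfl : i = j := by rw [← hg.color k i, h, hg.color]
  exact ⟨hg.injective i h, rfl⟩

variable [DecidableEq W]

theorem mem_map {K : PreAbstractSimplicialComplex V} {f : V → W} {s : Finset W} :
    s ∈ K.map f ↔ ∃ t ∈ K, t.image f = s := Iff.rfl

variable [DecidableEq V]

/-- The boundary complex of a cross-polytope in which the antipodal vertices of color `i` are `g i`
and `h i`. -/
def crossPolytopeOn (g h : Fin d → V) : PreAbstractSimplicialComplex V :=
  (crossPolytope d).map fun p => cond p.2 (h p.1) (g p.1)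

/-- The union of the cross-polytopes spanned by the pairs of layers `g k`, `g l` with `(k, l) ∈ P`,
from which the faces on the layers `g k` with `k ∈ B` have been removed. The cross-polytope,
its connected sums and `BM d` are all of this form. -/
def crossPolytopeUnion (g : ι → Fin d → V) (P : Set (ι × ι)) (B : Set ι) :
    PreAbstractSimplicialComplex V where
  faces := {s | (∃ p ∈ P, s ∈ crossPolytopeOn (g p.1) (g p.2)) ∧
    ∀ k ∈ B, ¬ Finset.univ.image (g k) ⊆ s}
  isRelLowerSet_faces := by
    rintro s ⟨⟨p, hp, hs⟩, hB⟩
    have hlower := (crossPolytopeOn (g p.1) (g p.2)).isRelLowerSet_faces hs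
    exact ⟨hlower.1, fun t hts ht =>
      ⟨⟨p, hp, hlower.2 hts ht⟩, fun k hk h => hB k hk (h.trans hts)⟩⟩

theorem mem_crossPolytopeUnion {g : ι → Fin d → V} {P : Set (ι × ι)} {B : Set ι} {s : Finset V} :
    s ∈ crossPolytopeUnion g P B ↔ (∃ p ∈ P, s ∈ crossPolytopeOn (g p.1) (g p.2)) ∧
      ∀ k ∈ B, ¬ Finset.univ.image (g k) ⊆ s := Iff.rfl

theorem crossPolytopeUnion_singleton (g : ι → Fin d → V) (k l : ι) :
    crossPolytopeUnion g {(k, l)} ∅ = crossPolytopeOn (g k) (g l) := by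
  refine SetLike.ext fun s => ?_
  simp [mem_crossPolytopeUnion]

theorem mem_crossPolytopeOn {κ : V → Fin d} {g h : Fin d → V} (hg : Function.LeftInverse κ g)
    (hh : Function.LeftInverse κ h) {s : Finset V} :
    s ∈ crossPolytopeOn g h ↔
      s.Nonempty ∧ Set.InjOn κ s ∧ ∀ v ∈ s, v = g (κ v) ∨ v = h (κ v) := by
  have hκ (p : Fin d × Bool) : κ (cond p.2 (h p.1) (g p.1)) = p.1 := by
    cases p.2 <;> simp [hg _, hh _]
  constructor
  · rintro ⟨t, ⟨hne, ht⟩, rfl⟩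
    refine ⟨hne.image _, ?_, ?_⟩
    · simp only [Set.InjOn, Finset.mem_coe, Finset.forall_mem_image, hκ]
      rintro ⟨i, a⟩ ha ⟨j, b⟩ hb rfl
      obtain rfl : a = b := by
        have := ht i
        cases a <;> cases b <;> simp_all
      rfl
    · simp only [Finset.forall_mem_image, hκ]
      rintro ⟨i, _ | _⟩ - <;> simp
  · rintro ⟨hne, hinj, hs⟩
    refine ⟨s.image fun v => (κ v, decide (v ≠ g (κ v))), ⟨hne.image _, fun i hi => ?_⟩, ?_⟩
    · simp only [Finset.mem_image, Prod.mk.injEq] at hi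
      obtain ⟨⟨u, hu, hui, hu'⟩, v, hv, hvi, hv'⟩ := hi
      obtain rfl := hinj hu hv (hui.trans hvi.symm)
      exact absurd (hu'.symm.trans hv') (by simp)
    · change (s.image _).image _ = s
      rw [Finset.image_image]
      refine (Finset.image_congr fun v hv => ?_).trans Finset.image_id
      by_cases h : v = g (κ v)
      · simp [← h]
      · simp [h, ← (hs v hv).resolve_left h]

theorem map_crossPolytopeOn (g h : Fin d → V) (f : V → W) :
    (crossPolytopeOn g h).map f = crossPolytopeOn (f ∘ g) (f ∘ h) := by
  have hf : (fun p : Fin d × Bool => cond p.2 ((f ∘ h) p.1) ((f ∘ g) p.1)) =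
      f ∘ fun p => cond p.2 (h p.1) (g p.1) := by
    ext ⟨i, _ | _⟩ <;> rfl
  refine SetLike.ext fun s => ?_
  simp only [crossPolytopeOn, mem_map, hf, exists_exists_and_eq_and, Finset.image_image]

theorem crossPolytopeUnion_comp (g : ι' → Fin d → V) (e : ι → ι') (P : Set (ι × ι)) (B : Set ι) :
    crossPolytopeUnion (g ∘ e) P B = crossPolytopeUnion g (Prod.map e e '' P) (e '' B) := by
  refine SetLike.ext fun s => ?_
  simp only [mem_crossPolytopeUnion, Set.exists_mem_image, Set.forall_mem_image,
    Function.comp_apply, Prod.map_fst, Prod.map_snd]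

theorem map_crossPolytopeUnion {g : ι → Fin d → V} (P : Set (ι × ι)) {B : Set ι} {f : V → W}
    (hf : ∀ k ∈ B, ∀ i v, f v = f (g k i) → v = g k i) :
    (crossPolytopeUnion g P B).map f = crossPolytopeUnion (fun k => f ∘ g k) P B := by
  have hB (t : Finset V) (k) (hk : k ∈ B) :
      Finset.univ.image (f ∘ g k) ⊆ t.image f ↔ Finset.univ.image (g k) ⊆ t := by
    rw [← Finset.image_image]
    refine ⟨fun h v hv => ?_, Finset.image_subset_image⟩
    obtain ⟨i, -, rfl⟩ := Finset.mem_image.1 hv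
    obtain ⟨u, hu, huv⟩ := Finset.mem_image.1 (h (Finset.mem_image_of_mem f hv))
    exact hf k hk i u huv ▸ hu
  refine SetLike.ext fun s => ?_
  simp only [mem_map, mem_crossPolytopeUnion, ← map_crossPolytopeOn]
  constructor
  · rintro ⟨t, ⟨⟨p, hp, ht⟩, htB⟩, rfl⟩
    exact ⟨⟨p, hp, t, ht, rfl⟩, fun k hk => (hB t k hk).not.2 (htB k hk)⟩
  · rintro ⟨⟨p, hp, t, ht, rfl⟩, htB⟩
    exact ⟨t, ⟨⟨p, hp, ht⟩, fun k hk => (hB t k hk).not.1 (htB k hk)⟩, rfl⟩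

theorem removeFace_crossPolytopeUnion (g : ι → Fin d → V) (P : Set (ι × ι)) (B : Set ι) (k : ι) :
    removeFace (crossPolytopeUnion g P B) (Finset.univ.image (g k)) =
      crossPolytopeUnion g P (insert k B) := by
  refine SetLike.ext fun s => ?_
  simp only [mem_crossPolytopeUnion, Set.forall_mem_insert]
  exact and_assoc.trans (and_congr_right' and_comm)

theorem IsLayering.mem_crossPolytopeOn {κ : V → Fin d} {g : ι → Fin d → V} (hg : IsLayering κ g)
    {k l : ι} {s : Finset V} : s ∈ crossPolytopeOn (g k) (g l) ↔
      s.Nonempty ∧ Set.InjOn κ s ∧ ∀ v ∈ s, v = g k (κ v) ∨ v = g l (κ v) :=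
  BalancedManifold.mem_crossPolytopeOn (hg.color k) (hg.color l)

theorem IsLayering.eq_or_eq_of_mem {κ : V → Fin d} {g : ι → Fin d → V} (hg : IsLayering κ g)
    {k l m : ι} {i : Fin d} {s : Finset V} (hs : s ∈ crossPolytopeOn (g k) (g l))
    (hi : g m i ∈ s) : m = k ∨ m = l := by
  simpa only [hg.color, hg.eq_iff, and_true] using (hg.mem_crossPolytopeOn.1 hs).2.2 _ hi

theorem crossPolytopeUnion_sup [NeZero d] {κ : V → Fin d} {g : ι → Fin d → V} (hg : IsLayering κ g)
    (P : Set (ι × ι)) {B : Set ι} {k l : ι} (hk : k ∉ B) (hl : l ∉ B) :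
    crossPolytopeUnion g P B ⊔ crossPolytopeOn (g k) (g l) =
      crossPolytopeUnion g (insert (k, l) P) B := by
  refine SetLike.ext fun s => ?_
  have hB (hs : s ∈ crossPolytopeOn (g k) (g l)) (m) (hm : m ∈ B) :
      ¬ Finset.univ.image (g m) ⊆ s := fun h => by
    rcases hg.eq_or_eq_of_mem hs (h (Finset.mem_image_of_mem _ (Finset.mem_univ 0)))
      with rfl | rfl
    exacts [hk hm, hl hm]
  change s ∈ crossPolytopeUnion g P B ∨ s ∈ crossPolytopeOn (g k) (g l) ↔ _
  simp only [mem_crossPolytopeUnion, Set.exists_mem_insert]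
  rw [or_and_right, and_iff_left_of_imp hB, or_comm]

end CrossPolytopeUnions

section LayeredFaces

variable {ι V : Type*} [DecidableEq V] {d : ℕ} {κ : V → Fin d} {g : ι → Fin d → V}
  {P : Set (ι × ι)} {B : Set ι}

theorem IsLayering.injOn_color (hg : IsLayering κ g) {s : Finset V}
    (hs : s ∈ crossPolytopeUnion g P B) : Set.InjOn κ s := by
  obtain ⟨⟨p, -, hp⟩, -⟩ := hs
  exact (hg.mem_crossPolytopeOn.1 hp).2.1

theorem IsLayering.insert_mem_crossPolytopeOn (hg : IsLayering κ g) {k l m : ι} {s : Finset V}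
    {i : Fin d} (hs : s ∈ crossPolytopeOn (g k) (g l)) (hi : ∀ v ∈ s, κ v ≠ i)
    (hm : m = k ∨ m = l) : insert (g m i) s ∈ crossPolytopeOn (g k) (g l) := by
  obtain ⟨-, hinj, hmem⟩ := hg.mem_crossPolytopeOn.1 hs
  refine hg.mem_crossPolytopeOn.2 ⟨s.insert_nonempty _, ?_, ?_⟩
  · rw [Finset.coe_insert, Set.injOn_insert (fun h => hi _ h (hg.color m i))]
    refine ⟨hinj, ?_⟩
    rintro ⟨v, hv, hvi⟩
    exact hi v hv (hvi.trans (hg.color m i))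
  · rw [Finset.forall_mem_insert]
    refine ⟨?_, hmem⟩
    simpa only [hg.color, hg.eq_iff, and_true] using hm

theorem IsLayering.eq_of_layer_subset_insert (hg : IsLayering κ g) {k m : ι} {s : Finset V}
    {i : Fin d} (hi : ∀ v ∈ s, κ v ≠ i) (h : Finset.univ.image (g k) ⊆ insert (g m i) s) :
    k = m ∧ ∀ j ≠ i, g m j ∈ s := by
  have hmem (j) : k = m ∧ j = i ∨ g k j ∈ s := by
    simpa [hg.eq_iff] using h (Finset.mem_image_of_mem _ (Finset.mem_univ j))
  obtain rfl : k = m := ((hmem i).resolve_right fun h => hi _ h (hg.color k i)).1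
  exact ⟨rfl, fun j hj => (hmem j).resolve_left fun h => hj h.2⟩

/-- A facet missing the color `i` would become a removed face by adding either vertex of color `i`
of its cross-polytope, and hence contain both vertices of every other color. -/
theorem IsLayering.isPure (hg : IsLayering κ g) (hd : 2 ≤ d) (hP : ∀ p ∈ P, p.1 ≠ p.2) :
    IsPure d (crossPolytopeUnion g P B) := by
  intro s hs
  obtain ⟨⟨p, hp, hsp⟩, -⟩ := hs.1
  refine (card_le_of_injOn_color (hg.injOn_color hs.1)).antisymm (not_lt.1 fun hlt => ?_)
  obtain ⟨i, hi⟩ := exists_color_notMem hlt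
  have hmem (m) (hm : m = p.1 ∨ m = p.2) (j) (hj : j ≠ i) : g m j ∈ s := by
    have hinsert : ¬ ∀ k ∈ B, ¬ Finset.univ.image (g k) ⊆ insert (g m i) s := fun h =>
      hi (g m i) (hs.2 ⟨⟨p, hp, hg.insert_mem_crossPolytopeOn hsp hi hm⟩, h⟩
        (Finset.subset_insert _ _) (Finset.mem_insert_self _ _)) (hg.color m i)
    push Not at hinsert
    obtain ⟨k, -, hk⟩ := hinsert
    exact (hg.eq_of_layer_subset_insert hi hk).2 j hj
  have : Nontrivial (Fin d) := Fin.nontrivial_iff_two_le.2 hd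
  obtain ⟨j, hj⟩ := exists_ne i
  refine hP p hp (hg.eq_iff.1 (hg.injOn_color hs.1 (hmem _ (.inl rfl) j hj)
    (hmem _ (.inr rfl) j hj) ?_)).1
  rw [hg.color, hg.color]

theorem IsLayering.image_layer_mem (hg : IsLayering κ g) [NeZero d] {k : ι} (hk : k ∉ B)
    (hkP : ∃ p ∈ P, k = p.1 ∨ k = p.2) :
    Finset.univ.image (g k) ∈ crossPolytopeUnion g P B := by
  obtain ⟨p, hp, hkp⟩ := hkP
  refine ⟨⟨p, hp, hg.mem_crossPolytopeOn.2 ⟨Finset.univ_nonempty.image _, ?_, ?_⟩⟩, ?_⟩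
  · rw [Finset.coe_image, Finset.coe_univ, Set.image_univ]
    rintro _ ⟨i, rfl⟩ _ ⟨j, rfl⟩ hij
    rw [hg.color, hg.color] at hij
    rw [hij]
  · simpa only [Finset.forall_mem_image, hg.color, hg.eq_iff, and_true] using fun _ _ => hkp
  · intro l hl h
    obtain ⟨i, -, hi⟩ := Finset.mem_image.1 (h (Finset.mem_image_of_mem _ (Finset.mem_univ 0)))
    exact hk ((hg.eq_iff.1 hi).1 ▸ hl)

theorem IsLayering.isFacet_layer (hg : IsLayering κ g) [NeZero d] {k : ι} (hk : k ∉ B)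
    (hkP : ∃ p ∈ P, k = p.1 ∨ k = p.2) :
    IsFacet (crossPolytopeUnion g P B) (Finset.univ.image (g k)) := by
  refine isFacet_of_card_eq (κ := κ) (fun s hs => hg.injOn_color hs) (hg.image_layer_mem hk hkP) ?_
  rw [Finset.card_image_of_injective _ (Function.LeftInverse.injective (hg.color k)),
    Finset.card_univ, Fintype.card_fin]

theorem IsLayering.exists_eq_of_isNeighbor (hg : IsLayering κ g) {k : ι} {i : Fin d} {u : V}
    (h : IsNeighbor (crossPolytopeUnion g P B) (g k i) u) :
    ∃ p ∈ P, (k = p.1 ∨ k = p.2) ∧ ∃ l j, (l = p.1 ∨ l = p.2) ∧ u = g l j := by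
  obtain ⟨-, ⟨p, hp, hs⟩, -⟩ := h
  refine ⟨p, hp, hg.eq_or_eq_of_mem hs (Finset.mem_insert_self _ _), ?_⟩
  rcases (hg.mem_crossPolytopeOn.1 hs).2.2 u (by simp) with hu | hu
  exacts [⟨_, _, .inl rfl, hu⟩, ⟨_, _, .inr rfl, hu⟩]

theorem IsLayering.vertices_eq (hg : IsLayering κ g) (hd : 2 ≤ d)
    (hP : ∀ k, ∃ p ∈ P, k = p.1 ∨ k = p.2) :
    vertices (crossPolytopeUnion g P B) = Set.range (Function.uncurry g) := by
  ext v
  constructor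
  · rintro ⟨⟨p, -, hp⟩, -⟩
    rcases (hg.mem_crossPolytopeOn.1 hp).2.2 v (by simp) with hv | hv
    exacts [⟨(_, _), hv.symm⟩, ⟨(_, _), hv.symm⟩]
  · rintro ⟨⟨k, i⟩, rfl⟩
    obtain ⟨p, hp, hk⟩ := hP k
    refine ⟨⟨p, hp, hg.mem_crossPolytopeOn.2 ⟨by simp, by simp, ?_⟩⟩, fun l _ h => ?_⟩
    · simpa [hg.color, hg.eq_iff] using hk
    · have hcard := Finset.card_le_card h
      rw [Finset.card_image_of_injective _ (Function.LeftInverse.injective (hg.color l)),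
        Finset.card_univ, Fintype.card_fin, Finset.card_singleton] at hcard
      omega

theorem IsLayering.isBalanced [Finite V] (hg : IsLayering κ g) (hd : 2 ≤ d)
    (hP : ∀ p ∈ P, p.1 ≠ p.2) (hPB : ∃ s, s ∈ crossPolytopeUnion g P B) :
    IsBalanced d (crossPolytopeUnion g P B) κ := by
  obtain ⟨s, hs⟩ := hPB
  exact (hg.isPure hd hP).isBalanced (fun t ht => hg.injOn_color ht) hs

theorem IsLayering.ncard_vertices (hg : IsLayering κ g) (hd : 2 ≤ d)
    (hP : ∀ k, ∃ p ∈ P, k = p.1 ∨ k = p.2) :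
    (vertices (crossPolytopeUnion g P B)).ncard = Nat.card ι * d := by
  have hinj : Function.Injective (Function.uncurry g) := fun _ _ h =>
    Prod.ext_iff.2 (hg.eq_iff.1 h)
  rw [hg.vertices_eq hd hP, ← Nat.card_coe_set_eq, Nat.card_range_of_injective hinj, Nat.card_prod,
    Nat.card_fin]

end LayeredFaces

section Construction

variable {d : ℕ}

/-- The layers of the cross-polytope, as its two facets `{x i}` and `{y i}`. -/
def layers₁ (d : ℕ) : Fin 2 → Fin d → Fin d × Bool :=
  ![fun i => (i, false), fun i => (i, true)]

/-- The layers `x`, `y = y'`, `z` of the sum of two cross-polytopes. -/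
def layers₂ (d : ℕ) : Fin 3 → Fin d → Vert₂ d :=
  ![fun i => Sum.inl (i, false), fun i => Sum.inr (i, false), fun i => Sum.inr (i, true)]

/-- The layers `x`, `y = y'`, `z = z'`, `x'` of the sum of three cross-polytopes. -/
def layers₃ (d : ℕ) : Fin 4 → Fin d → Vert₃ d :=
  ![fun i => Sum.inl (Sum.inl (i, false)), fun i => Sum.inl (Sum.inr (i, false)),
    fun i => Sum.inr (i, false), fun i => Sum.inr (i, true)]

/-- The layers `x = x'`, `y = y'`, `z = z'` of `BM d`. -/
def layersBM (d : ℕ) : Fin 3 → Fin d → Vert₃ d :=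
  ![fun i => Sum.inr (i, true), fun i => Sum.inl (Sum.inr (i, false)), fun i => Sum.inr (i, false)]

theorem isLayering_layers₁ : IsLayering (color₁ d) (layers₁ d) where
  color k i := by fin_cases k <;> rfl
  injective i k l h := by fin_cases k <;> fin_cases l <;> simp_all [layers₁]

theorem isLayering_layers₂ : IsLayering (color₂ d) (layers₂ d) where
  color k i := by fin_cases k <;> rfl
  injective i k l h := by fin_cases k <;> fin_cases l <;> simp_all [layers₂]

theorem isLayering_layers₃ : IsLayering (color₃ d) (layers₃ d) where
  color k i := by fin_cases k <;> rfl
  injective i k l h := by fin_cases k <;> fin_cases l <;> simp_all [layers₃]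

theorem isLayering_layersBM : IsLayering (color₃ d) (layersBM d) where
  color k i := by fin_cases k <;> rfl
  injective i k l h := by fin_cases k <;> fin_cases l <;> simp_all [layersBM]

theorem map_crossPolytope {V : Type*} [DecidableEq V] (f : Fin d × Bool → V) :
    (crossPolytope d).map f = crossPolytopeOn (fun i => f (i, false)) fun i => f (i, true) := by
  have hf : (fun p : Fin d × Bool => cond p.2 (f (p.1, true)) (f (p.1, false))) = f := by
    ext ⟨i, _ | _⟩ <;> rfl
  rw [crossPolytopeOn, hf]

theorem crossPolytope_eq : crossPolytope d = crossPolytopeUnion (layers₁ d) {(0, 1)} ∅ := by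
  have hid : (crossPolytope d).map id = crossPolytope d := SetLike.ext fun s => by simp [mem_map]
  rw [crossPolytopeUnion_singleton, ← hid, map_crossPolytope]
  rfl

theorem sum₂_eq [NeZero d] :
    sum₂ d = crossPolytopeUnion (layers₂ d) {(1, 2), (0, 1)} {1} := by
  have hleft : (crossPolytope d).map
      (fun v => if v ∈ facetY d then Sum.inr (glueY d v) else Sum.inl v) =
      crossPolytopeUnion (layers₂ d) {(0, 1)} ∅ := by
    rw [map_crossPolytope, crossPolytopeUnion_singleton]
    simp [facetY, glueY, color₁, layers₂]
  have hright : (crossPolytope d).map Sum.inr =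
      crossPolytopeOn (layers₂ d 1) (layers₂ d 2) := map_crossPolytope _
  have hface : (facetY d).image (fun v => Sum.inr (glueY d v)) =
      Finset.univ.image (layers₂ d 1) := by
    rw [facetY, Finset.image_image]
    rfl
  rw [sum₂, connectedSum, hleft, hright, hface,
    crossPolytopeUnion_sup isLayering_layers₂ _ (Set.notMem_empty _) (Set.notMem_empty _),
    removeFace_crossPolytopeUnion, insert_empty_eq]

theorem sum₃_eq [NeZero d] :
    sum₃ d = crossPolytopeUnion (layers₃ d) {(2, 3), (1, 2), (0, 1)} {1, 2} := by
  have hleft : (sum₂ d).map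
      (fun v => if v ∈ facetZ d then Sum.inr (glueZ d v) else Sum.inl v) =
      crossPolytopeUnion (layers₃ d) {(1, 2), (0, 1)} {1} := by
    have hlayers : (fun k => (fun v => if v ∈ facetZ d then Sum.inr (glueZ d v) else Sum.inl v) ∘
        layers₂ d k) = layers₃ d ∘ ![0, 1, 2] := by
      funext k i
      fin_cases k <;> simp [facetZ, glueZ, color₂, color₁, layers₂, layers₃]
    rw [sum₂_eq, map_crossPolytopeUnion, hlayers, crossPolytopeUnion_comp]
    · simp [Set.image_insert_eq]
    · rintro _ rfl i (⟨j, _ | _⟩ | ⟨j, _ | _⟩) <;> simp [layers₂, facetZ]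
  have hright : (crossPolytope d).map Sum.inr =
      crossPolytopeOn (layers₃ d 2) (layers₃ d 3) := map_crossPolytope _
  have hface : (facetZ d).image (fun v => Sum.inr (glueZ d v)) =
      Finset.univ.image (layers₃ d 2) := by
    rw [facetZ, Finset.image_image]
    rfl
  rw [sum₃, connectedSum, hleft, hright, hface,
    crossPolytopeUnion_sup isLayering_layers₃ _ (by simp) (by simp),
    removeFace_crossPolytopeUnion, Set.pair_comm 2 1]

theorem BM_eq [NeZero d] :
    BM d = crossPolytopeUnion (layersBM d) (Set.range fun k => (k, k + 1)) Set.univ := by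
  have hlayers : (fun k => (fun v => if v ∈ facetX d then glueX d v else v) ∘ layers₃ d k) =
      layersBM d ∘ ![0, 1, 2, 0] := by
    funext k i
    fin_cases k <;> simp [facetX, glueX, color₃, color₂, color₁, layers₃, layersBM]
  have hface : (facetX d).image (glueX d) = Finset.univ.image (layersBM d 0) := by
    rw [facetX, Finset.image_image]
    rfl
  have hpairs : Prod.map ![0, 1, 2, 0] ![0, 1, 2, 0] ''
      {((2 : Fin 4), (3 : Fin 4)), (1, 2), (0, 1)} = Set.range fun k : Fin 3 => (k, k + 1) := by
    ext ⟨k, l⟩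
    simp only [Set.image_insert_eq, Set.image_singleton, Set.mem_insert_iff, Set.mem_singleton_iff,
      Set.mem_range, Prod.map, Prod.mk.injEq]
    revert k l
    decide
  have huniv : insert (0 : Fin 3) (![0, 1, 2, 0] '' {(1 : Fin 4), 2}) = Set.univ := by
    simp [Set.image_insert_eq, Set.eq_univ_iff_forall, Fin.forall_fin_succ]
  rw [BM, handleAddition, sum₃_eq, map_crossPolytopeUnion, hlayers, crossPolytopeUnion_comp, hface,
    removeFace_crossPolytopeUnion, hpairs, huniv]
  rintro _ (rfl | rfl) i ((⟨j, _ | _⟩ | ⟨j, _ | _⟩) | ⟨j, _ | _⟩) <;>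
    simp [layers₃, facetX, glueX]

theorem isPure_crossPolytope (hd : 2 ≤ d) : IsPure d (crossPolytope d) := by
  rw [crossPolytope_eq]
  exact isLayering_layers₁.isPure hd (by simp)

theorem isFacet_crossPolytope_layer [NeZero d] (k : Fin 2) :
    IsFacet (crossPolytope d) (Finset.univ.image (layers₁ d k)) := by
  rw [crossPolytope_eq]
  refine isLayering_layers₁.isFacet_layer (Set.notMem_empty _) ?_
  fin_cases k <;> simp

theorem isFacet_sum₂_facetZ [NeZero d] : IsFacet (sum₂ d) (facetZ d) := by
  rw [sum₂_eq]
  exact isLayering_layers₂.isFacet_layer (k := 2) (by simp) (by simp)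

theorem isFacet_sum₃_facetX [NeZero d] : IsFacet (sum₃ d) (facetX d) := by
  rw [sum₃_eq]
  exact isLayering_layers₃.isFacet_layer (k := 0) (by simp) (by simp)

theorem isFacet_sum₃_image_facetX [NeZero d] : IsFacet (sum₃ d) ((facetX d).image (glueX d)) := by
  rw [facetX, Finset.image_image, sum₃_eq]
  exact isLayering_layers₃.isFacet_layer (k := 3) (by simp) (by simp)

theorem isBalanced_crossPolytope (hd : 2 ≤ d) : IsBalanced d (crossPolytope d) (color₁ d) := by
  have : NeZero d := ⟨by omega⟩
  have hne := (isFacet_crossPolytope_layer (d := d) 0).1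
  rw [crossPolytope_eq] at hne ⊢
  exact isLayering_layers₁.isBalanced hd (by simp) ⟨_, hne⟩

theorem isBalanced_sum₂ (hd : 2 ≤ d) : IsBalanced d (sum₂ d) (color₂ d) := by
  have : NeZero d := ⟨by omega⟩
  have hne := (isFacet_sum₂_facetZ (d := d)).1
  rw [sum₂_eq] at hne ⊢
  exact isLayering_layers₂.isBalanced hd (by simp) ⟨_, hne⟩

theorem isBalanced_sum₃ (hd : 2 ≤ d) : IsBalanced d (sum₃ d) (color₃ d) := by
  have : NeZero d := ⟨by omega⟩
  have hne := (isFacet_sum₃_facetX (d := d)).1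
  rw [sum₃_eq] at hne ⊢
  exact isLayering_layers₃.isBalanced hd (by simp) ⟨_, hne⟩

theorem isBalanced_BM (hd : 2 ≤ d) : IsBalanced d (BM d) (color₃ d) := by
  have : NeZero d := ⟨by omega⟩
  have hP : ∀ k : Fin 3, ∃ p ∈ Set.range fun k : Fin 3 => (k, k + 1), k = p.1 ∨ k = p.2 :=
    fun k => ⟨_, ⟨k, rfl⟩, .inl rfl⟩
  have hne := (isLayering_layersBM.vertices_eq (B := Set.univ) hd hP).ge ⟨(0, 0), rfl⟩
  rw [BM_eq]
  exact isLayering_layersBM.isBalanced hd (by simp) ⟨_, hne⟩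

theorem isBalancedConnectedSum_crossPolytope (hd : 2 ≤ d) :
    IsBalancedConnectedSum d (crossPolytope d) (color₁ d) (crossPolytope d) (color₁ d)
      (facetY d) (glueY d) where
  balanced_left := isBalanced_crossPolytope hd
  balanced_right := isBalanced_crossPolytope hd
  pure_left := isPure_crossPolytope hd
  pure_right := isPure_crossPolytope hd
  facet_left := have : NeZero d := ⟨by omega⟩; isFacet_crossPolytope_layer 1
  facet_right := by
    have : NeZero d := ⟨by omega⟩
    rw [facetY, Finset.image_image]
    exact isFacet_crossPolytope_layer 0
  injOn := by
    simp only [Set.InjOn, Finset.mem_coe, facetY, Finset.forall_mem_image]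
    simp [glueY, color₁]
  color _ _ := rfl

theorem isBalancedConnectedSum_sum₂ (hd : 2 ≤ d) :
    IsBalancedConnectedSum d (sum₂ d) (color₂ d) (crossPolytope d) (color₁ d)
      (facetZ d) (glueZ d) where
  balanced_left := isBalanced_sum₂ hd
  balanced_right := isBalanced_crossPolytope hd
  pure_left := by
    have : NeZero d := ⟨by omega⟩
    rw [sum₂_eq]
    exact isLayering_layers₂.isPure hd (by simp)
  pure_right := isPure_crossPolytope hd
  facet_left := have : NeZero d := ⟨by omega⟩; isFacet_sum₂_facetZ
  facet_right := by
    have : NeZero d := ⟨by omega⟩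
    rw [facetZ, Finset.image_image]
    exact isFacet_crossPolytope_layer 0
  injOn := by
    simp only [Set.InjOn, Finset.mem_coe, facetZ, Finset.forall_mem_image]
    simp [glueZ, color₂, color₁]
  color _ _ := rfl

theorem not_isNeighbor_sum₃_glueX [NeZero d] {v : Vert₃ d} (hv : v ∈ facetX d) (u : Vert₃ d) :
    ¬ (IsNeighbor (sum₃ d) v u ∧ IsNeighbor (sum₃ d) (glueX d v) u) := by
  obtain ⟨i, -, rfl⟩ := Finset.mem_image.1 hv
  rw [sum₃_eq]
  rintro ⟨hx, hx'⟩
  obtain ⟨p, hp, h0, k, j, hk, rfl⟩ :=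
    isLayering_layers₃.exists_eq_of_isNeighbor (k := 0) (i := i) hx
  obtain ⟨q, hq, h3, l, j', hl, he⟩ :=
    isLayering_layers₃.exists_eq_of_isNeighbor (k := 3) (i := i) hx'
  obtain ⟨rfl, -⟩ := isLayering_layers₃.eq_iff.1 he
  obtain rfl : p = (0, 1) := by
    rcases hp with rfl | rfl | rfl <;> simp_all
  obtain rfl : q = (2, 3) := by
    rcases hq with rfl | rfl | rfl <;> simp_all
  rcases hk with rfl | rfl <;> simp at hl

theorem isBalancedHandleAddition_sum₃ (hd : 2 ≤ d) :
    IsBalancedHandleAddition d (sum₃ d) (color₃ d) (facetX d) (glueX d) where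
  balanced := isBalanced_sum₃ hd
  pure := by
    have : NeZero d := ⟨by omega⟩
    rw [sum₃_eq]
    exact isLayering_layers₃.isPure hd (by simp)
  facet := have : NeZero d := ⟨by omega⟩; isFacet_sum₃_facetX
  facet' := have : NeZero d := ⟨by omega⟩; isFacet_sum₃_image_facetX
  disjoint := by
    simp [Finset.disjoint_left, facetX, glueX]
  injOn := by
    simp only [Set.InjOn, Finset.mem_coe, facetX, Finset.forall_mem_image]
    simp [glueX, color₃, color₂, color₁]
  color _ _ := rfl
  no_common_neighbor _ hv u :=
    have : NeZero d := ⟨by omega⟩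
    not_isNeighbor_sum₃_glueX hv u

theorem ncard_vertices_BM (hd : 2 ≤ d) : (vertices (BM d)).ncard = 3 * d := by
  have : NeZero d := ⟨by omega⟩
  rw [BM_eq, isLayering_layersBM.ncard_vertices hd, Nat.card_fin]
  exact fun k => ⟨_, ⟨k, rfl⟩, .inl rfl⟩

end Construction

section Realization

variable {ι V : Type*} [DecidableEq V] {d : ℕ} {κ : V → Fin d} {g : ι → Fin d → V}

/-- The point with barycentric coordinates `(u i)⁻` at `g i` and `(u i)⁺` at `h i`. This identifies
the `ℓ¹`-unit sphere of `ℝ^d` with the realization of `crossPolytopeOn g h`. -/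
def crossPoint (g h : Fin d → V) (u : Fin d → ℝ) : V → ℝ :=
  ∑ i, (Pi.single (h i) (u i)⁺ + Pi.single (g i) (u i)⁻)

theorem crossPoint_apply {g h : Fin d → V} (hg : Function.LeftInverse κ g)
    (hh : Function.LeftInverse κ h) (u : Fin d → ℝ) (v : V) :
    crossPoint g h u v =
      (if v = h (κ v) then (u (κ v))⁺ else 0) + if v = g (κ v) then (u (κ v))⁻ else 0 := by
  rw [crossPoint, Finset.sum_apply, Finset.sum_eq_single (κ v)]
  · simp only [Pi.add_apply, Pi.single_apply]
  · intro i _ hi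
    have hvg : v ≠ g i := fun h => hi (by rw [h, hg])
    have hvh : v ≠ h i := fun h => hi (by rw [h, hh])
    simp [hvg, hvh]
  · simp

theorem IsLayering.crossPoint_apply [DecidableEq ι] (hg : IsLayering κ g) (k l m : ι)
    (u : Fin d → ℝ) (i : Fin d) : crossPoint (g k) (g l) u (g m i) =
      (if m = l then (u i)⁺ else 0) + if m = k then (u i)⁻ else 0 := by
  simp only [BalancedManifold.crossPoint_apply (hg.color k) (hg.color l), hg.color, hg.eq_iff,
    and_true]

theorem IsLayering.crossPoint_injective (hg : IsLayering κ g) {k l : ι} (hkl : k ≠ l) :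
    Function.Injective (crossPoint (g k) (g l)) := by
  classical
  intro u u' h
  funext i
  have hl := congrFun h (g l i)
  have hk := congrFun h (g k i)
  simp only [hg.crossPoint_apply, if_true, if_neg hkl, if_neg hkl.symm, add_zero, zero_add]
    at hl hk
  rw [← posPart_sub_negPart (u i), hl, hk, posPart_sub_negPart]

theorem crossPoint_eq_crossPoint_neg {u : Fin d → ℝ} (hu : 0 ≤ u) (g h f : Fin d → V) :
    crossPoint g h u = crossPoint h f (-u) := by
  refine Finset.sum_congr rfl fun i _ => ?_
  have hi := hu i
  simp only [Pi.neg_apply, posPart_neg, negPart_neg, negPart_eq_zero.2 hi, Pi.single_zero, add_zero,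
    zero_add]

theorem IsLayering.eq_neg_of_crossPoint_eq (hg : IsLayering κ g) {k l m : ι} (hkl : k ≠ l)
    (hlm : l ≠ m) (hkm : k ≠ m) {u u' : Fin d → ℝ}
    (h : crossPoint (g k) (g l) u = crossPoint (g l) (g m) u') : 0 ≤ u ∧ u' = -u := by
  classical
  have hk (i) := congrFun h (g k i)
  have hl (i) := congrFun h (g l i)
  have hm (i) := congrFun h (g m i)
  simp only [hg.crossPoint_apply, if_true, if_neg hkl, if_neg hkl.symm, if_neg hlm,
    if_neg hlm.symm, if_neg hkm, if_neg hkm.symm, add_zero, zero_add] at hk hl hm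
  refine ⟨fun i => negPart_eq_zero.1 (hk i), funext fun i => ?_⟩
  rw [Pi.neg_apply, ← posPart_sub_negPart (u' i), ← hm i, ← hl i, ← posPart_sub_negPart (u i), hk i]
  simp

theorem continuous_crossPoint (g h : Fin d → V) : Continuous (crossPoint g h) := by
  refine continuous_finsetSum _ fun i _ => .add ?_ ?_
  · exact (continuous_single _).comp (continuous_posPart.comp (continuous_apply i))
  · exact (continuous_single _).comp (continuous_negPart.comp (continuous_apply i))

theorem crossPoint_nonneg (g h : Fin d → V) (u : Fin d → ℝ) : 0 ≤ crossPoint g h u :=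
  Finset.sum_nonneg fun i _ => add_nonneg (Pi.single_nonneg.2 (posPart_nonneg (u i)))
    (Pi.single_nonneg.2 (negPart_nonneg (u i)))

theorem crossPoint_mem_stdSimplex_iff [Fintype V] {g h : Fin d → V} {u : Fin d → ℝ} :
    crossPoint g h u ∈ stdSimplex ℝ V ↔ ∑ i, |u i| = 1 := by
  have hsum : ∑ v, crossPoint g h u v = ∑ i, |u i| := by
    simp only [crossPoint, Finset.sum_apply, Pi.add_apply]
    rw [Finset.sum_comm]
    simp [Finset.sum_add_distrib, ← posPart_add_negPart]
  rw [← hsum]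
  exact and_iff_right (crossPoint_nonneg g h u)

theorem support_crossPoint_mem [Fintype V] {g h : Fin d → V} (hg : Function.LeftInverse κ g)
    (hh : Function.LeftInverse κ h) {u : Fin d → ℝ} (hu : crossPoint g h u ≠ 0) :
    (Finset.univ.filter fun v => crossPoint g h u v ≠ 0) ∈ crossPolytopeOn g h := by
  have hmem {v} (hv : crossPoint g h u v ≠ 0) :
      0 < u (κ v) ∧ v = h (κ v) ∨ u (κ v) < 0 ∧ v = g (κ v) := by
    rw [crossPoint_apply hg hh] at hv
    contrapose! hv
    rcases lt_trichotomy (u (κ v)) 0 with hu | hu | hu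
    · simp [posPart_eq_zero.2 hu.le, hv.2 hu]
    · simp [hu]
    · simp [negPart_eq_zero.2 hu.le, hv.1 hu]
  simp only [mem_crossPolytopeOn hg hh, Finset.mem_filter_univ, Set.InjOn, Finset.mem_coe]
  refine ⟨?_, fun v hv v' hv' hvv' => ?_, fun v hv => (hmem hv).symm.imp And.right And.right⟩
  · obtain ⟨v, hv⟩ := Function.ne_iff.1 hu
    exact ⟨v, Finset.mem_filter_univ v |>.2 hv⟩
  · have hv'' := hmem hv'
    rw [← hvv'] at hv''
    rcases hmem hv with ⟨hpos, hv⟩ | ⟨hneg, hv⟩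
    · exact hv.trans (hv''.resolve_right fun h => h.1.not_gt hpos).2.symm
    · exact hv.trans (hv''.resolve_left fun h => h.1.not_gt hneg).2.symm

theorem crossPoint_sub {g h : Fin d → V} (hg : Function.LeftInverse κ g)
    (hh : Function.LeftInverse κ h) (hgh : ∀ i, g i ≠ h i) {s : Finset V}
    (hs : s ∈ crossPolytopeOn g h) {w : V → ℝ} (hw : 0 ≤ w) (hws : ∀ v ∉ s, w v = 0) :
    crossPoint g h (fun i => w (h i) - w (g i)) = w := by
  obtain ⟨-, hinj, hmem⟩ := (mem_crossPolytopeOn hg hh).1 hs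
  have hparts (i) : (w (h i) - w (g i))⁺ = w (h i) ∧ (w (h i) - w (g i))⁻ = w (g i) := by
    have hzero : w (g i) = 0 ∨ w (h i) = 0 := by
      by_contra! hne
      exact hgh i (hinj (not_imp_comm.1 (hws _) hne.1) (not_imp_comm.1 (hws _) hne.2)
        ((hg i).trans (hh i).symm))
    have hgi := hw (g i)
    have hhi := hw (h i)
    rcases hzero with h0 | h0 <;> simp_all
  funext v
  rw [crossPoint_apply hg hh, (hparts _).1, (hparts _).2]
  by_cases hvh : v = h (κ v)
  · have hvg : v ≠ g (κ v) := fun hvg => hgh _ (hvg.symm.trans hvh)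
    rw [if_pos hvh, if_neg hvg, add_zero, ← hvh]
  · by_cases hvg : v = g (κ v)
    · rw [if_neg hvh, if_pos hvg, zero_add, ← hvg]
    · rw [if_neg hvh, if_neg hvg, add_zero, hws v fun hv => (hmem v hv).elim hvg hvh]

theorem IsLayering.mem_realization [Fintype V] [NeZero d] {P : Set (ι × ι)} {B : Set ι}
    (hg : IsLayering κ g) (hP : ∀ p ∈ P, p.1 ≠ p.2) {w : V → ℝ} :
    w ∈ realization (crossPolytopeUnion g P B) ↔ ∃ p ∈ P, ∃ u : Fin d → ℝ, ∑ i, |u i| = 1 ∧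
      (p.1 ∈ B → ∃ i, 0 ≤ u i) ∧ (p.2 ∈ B → ∃ i, u i ≤ 0) ∧
      crossPoint (g p.1) (g p.2) u = w := by
  classical
  constructor
  · rintro ⟨hw, s, ⟨⟨p, hp, hs⟩, hB⟩, hws⟩
    have hu : crossPoint (g p.1) (g p.2) (fun i => w (g p.2 i) - w (g p.1 i)) = w :=
      crossPoint_sub (hg.color _) (hg.color _)
        (fun i h => hP p hp (hg.injective i h)) hs hw.1 hws
    have hlayer (k) (hk : k ∈ B) : ∃ i, w (g k i) = 0 := by
      obtain ⟨v, hv, hvs⟩ := Finset.not_subset.1 (hB k hk)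
      obtain ⟨i, -, rfl⟩ := Finset.mem_image.1 hv
      exact ⟨i, hws _ hvs⟩
    refine ⟨p, hp, _, ?_, fun hk => ?_, fun hk => ?_, hu⟩
    · exact crossPoint_mem_stdSimplex_iff.1 (hu ▸ hw)
    · obtain ⟨i, hi⟩ := hlayer _ hk
      exact ⟨i, by simpa [hi] using hw.1 (g p.2 i)⟩
    · obtain ⟨i, hi⟩ := hlayer _ hk
      exact ⟨i, by simpa [hi] using hw.1 (g p.1 i)⟩
  · rintro ⟨p, hp, u, hu, hu1, hu2, rfl⟩
    have hw := (crossPoint_mem_stdSimplex_iff (g := g p.1) (h := g p.2)).2 hu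
    have hs := support_crossPoint_mem (hg.color p.1) (hg.color p.2) (u := u)
      (fun h0 => by simpa [h0] using hw.2)
    refine ⟨hw, _, ⟨⟨p, hp, hs⟩, fun k hk hks => ?_⟩, fun v hv => by simpa using hv⟩
    have hne (i) : crossPoint (g p.1) (g p.2) u (g k i) ≠ 0 := by
      simpa using hks (Finset.mem_image_of_mem _ (Finset.mem_univ i))
    have hpk := hP p hp
    rcases hg.eq_or_eq_of_mem hs (hks (Finset.mem_image_of_mem _ (Finset.mem_univ 0)))
      with rfl | rfl
    · obtain ⟨i, hi⟩ := hu1 hk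
      simpa [hg.crossPoint_apply, hpk, hi] using hne i
    · obtain ⟨i, hi⟩ := hu2 hk
      simpa [hg.crossPoint_apply, hpk.symm, hi] using hne i

end Realization

section Profiles

variable {ι : Type*} [Fintype ι] [Nonempty ι]

/-- The largest coordinate of `y`; the smallest one is `-maxCoord (-y)`. -/
def maxCoord (y : ι → ℝ) : ℝ := Finset.univ.sup' Finset.univ_nonempty y

/-- The difference of the largest and the smallest coordinate of `y`. -/
def spread (y : ι → ℝ) : ℝ := maxCoord y + maxCoord (-y)

/-- The translate of `y` by a constant for which zero divides the range of the coordinates in the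
ratio `1 - s : s`. Up to scaling, every vector with coordinates of both signs is of this form. -/
def profile (y : ι → ℝ) (s : ℝ) : ι → ℝ :=
  fun i => y i - ((1 - s) * maxCoord y - s * maxCoord (-y))

theorem le_maxCoord (y : ι → ℝ) (i : ι) : y i ≤ maxCoord y := Finset.le_sup' y (Finset.mem_univ i)

theorem exists_eq_maxCoord (y : ι → ℝ) : ∃ i, y i = maxCoord y := by
  obtain ⟨i, -, hi⟩ := Finset.exists_mem_eq_sup' Finset.univ_nonempty y
  exact ⟨i, hi.symm⟩

theorem maxCoord_smul {c : ℝ} (hc : 0 ≤ c) (y : ι → ℝ) : maxCoord (c • y) = c * maxCoord y :=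
  (Finset.mul₀_sup' hc y Finset.univ Finset.univ_nonempty).symm

theorem maxCoord_add_const (y : ι → ℝ) (c : ℝ) :
    maxCoord (y + Function.const ι c) = maxCoord y + c :=
  (Finset.apply_sup'_eq_sup'_comp Finset.univ_nonempty (· + c)
    fun a b => max_add_add_right a b c |>.symm).symm

@[fun_prop]
theorem continuous_maxCoord : Continuous (maxCoord : (ι → ℝ) → ℝ) :=
  Continuous.finset_sup'_apply Finset.univ_nonempty fun i _ => continuous_apply i

theorem spread_pos {y : ι → ℝ} {i j : ι} (hij : y i ≠ y j) : 0 < spread y := by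
  have hi' := le_maxCoord (-y) i
  have hj' := le_maxCoord (-y) j
  simp only [Pi.neg_apply] at hi' hj'
  rw [spread]
  rcases hij.lt_or_gt with h | h <;> linarith [le_maxCoord y i, le_maxCoord y j]

theorem spread_nonneg (y : ι → ℝ) : 0 ≤ spread y := by
  obtain ⟨i, hi⟩ := exists_eq_maxCoord y
  have := le_maxCoord (-y) i
  rw [Pi.neg_apply] at this
  rw [spread]
  linarith

theorem spread_neg (y : ι → ℝ) : spread (-y) = spread y := by
  rw [spread, neg_neg, add_comm, spread]

theorem exists_profile_eq_mul (y : ι → ℝ) (s : ℝ) :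
    ∃ i, profile y s i = s * spread y := by
  obtain ⟨i, hi⟩ := exists_eq_maxCoord y
  exact ⟨i, by rw [profile, hi, spread]; ring⟩

theorem profile_neg (y : ι → ℝ) (s : ℝ) : profile (-y) (1 - s) = -profile y s := by
  funext i
  simp only [profile, Pi.neg_apply, neg_neg]
  ring

theorem exists_profile_eq_neg_mul (y : ι → ℝ) (s : ℝ) :
    ∃ i, profile y s i = -((1 - s) * spread y) := by
  obtain ⟨i, hi⟩ := exists_profile_eq_mul (-y) (1 - s)
  refine ⟨i, ?_⟩
  rw [profile_neg, Pi.neg_apply, spread_neg] at hi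
  exact neg_eq_iff_eq_neg.1 hi

theorem profile_smul {c : ℝ} (hc : 0 ≤ c) (y : ι → ℝ) (s : ℝ) :
    profile (c • y) s = c • profile y s := by
  funext i
  simp only [profile, ← smul_neg, maxCoord_smul hc, Pi.smul_apply, smul_eq_mul]
  ring

theorem profile_add_const (y : ι → ℝ) (c s : ℝ) :
    profile (y + Function.const ι c) s = profile y s := by
  have hneg : -(y + Function.const ι c) = -y + Function.const ι (-c) := by
    funext i
    simp [add_comm]
  funext i
  simp only [profile, hneg, maxCoord_add_const, Pi.add_apply, Function.const_apply]
  ring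

theorem profile_nonneg_iff {y : ι → ℝ} {i j : ι} (hij : y i ≠ y j) {s : ℝ} :
    0 ≤ profile y s ↔ 1 ≤ s := by
  constructor
  · intro h
    obtain ⟨k, hk⟩ := exists_profile_eq_neg_mul y s
    have hle : (1 - s) * spread y ≤ 0 := neg_nonneg.1 (hk ▸ h k)
    exact sub_nonpos.1 (nonpos_of_mul_nonpos_left hle (spread_pos hij))
  · intro hs k
    have hmin := le_maxCoord (-y) k
    have hmul := mul_nonneg (sub_nonneg.2 hs) (spread_nonneg y)
    rw [Pi.neg_apply] at hmin
    rw [spread] at hmul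
    rw [profile, Pi.zero_apply]
    linarith

theorem exists_profile_eq_self {u : ι → ℝ} (hu : u ≠ 0) {i j : ι} (hi : 0 ≤ u i) (hj : u j ≤ 0) :
    ∃ s ∈ Set.Icc (0 : ℝ) 1, profile u s = u := by
  have hM : 0 ≤ maxCoord u := hi.trans (le_maxCoord u i)
  have hN : 0 ≤ maxCoord (-u) := (neg_nonneg.2 hj).trans (le_maxCoord (-u) j)
  have hMN : 0 < maxCoord u + maxCoord (-u) := by
    obtain ⟨k, hk⟩ := Function.ne_iff.1 hu
    have hkN := le_maxCoord (-u) k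
    rw [Pi.neg_apply] at hkN
    rcases lt_or_gt_of_ne hk with h | h <;> rw [Pi.zero_apply] at h <;>
      linarith [le_maxCoord u k]
  refine ⟨maxCoord u / (maxCoord u + maxCoord (-u)), ⟨by positivity, ?_⟩, ?_⟩
  · exact div_le_one_of_le₀ (by linarith) hMN.le
  · funext k
    rw [profile]
    field_simp
    ring

theorem eq_of_profile_eq {y y' : ι → ℝ} {s s' : ℝ} (h : profile y s = profile y' s') {i j : ι}
    (hi : y i = y' i) (hij : y i ≠ y j) : y = y' ∧ s = s' := by
  have hconst (k) := congrFun h k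
  simp only [profile] at hconst
  obtain rfl : y = y' := funext fun k => by linarith [hconst k, hconst i]
  have hmul : (s' - s) * spread y = 0 := by
    rw [spread]
    linarith [hconst i]
  exact ⟨rfl, (sub_eq_zero.1 ((mul_eq_zero.1 hmul).resolve_right (spread_pos hij).ne')).symm⟩

theorem continuous_profile : Continuous fun p : (ι → ℝ) × ℝ => profile p.1 p.2 := by
  unfold profile
  fun_prop

end Profiles

section SphereProfiles

variable {n : ℕ}

/-- The representative with vanishing first coordinate of a point of `ℝ^{n+2}` modulo constant
vectors, a space identified with `ℝ^{n+1}`. -/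
def height (x : EuclideanSpace ℝ (Fin (n + 1))) : Fin (n + 2) → ℝ := Fin.cons 0 x

theorem height_neg (x : EuclideanSpace ℝ (Fin (n + 1))) : height (-x) = -height x := by
  funext i
  cases i using Fin.cases <;> simp [height]

theorem height_smul (c : ℝ) (x : EuclideanSpace ℝ (Fin (n + 1))) :
    height (c • x) = c • height x := by
  funext i
  cases i using Fin.cases <;> simp [height]

theorem height_injective : Function.Injective (height (n := n)) := fun x x' h => by
  ext i
  simpa [height] using congrFun h i.succ

@[fun_prop]
theorem continuous_height : Continuous (height (n := n)) :=
  continuous_const.finCons (PiLp.continuous_ofLp 2 _)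

theorem exists_height_ne {x : EuclideanSpace ℝ (Fin (n + 1))} (hx : x ≠ 0) :
    ∃ i, height x 0 ≠ height x i := by
  contrapose! hx
  ext i
  exact (hx i.succ).symm

theorem exists_height_eq_add_const (u : Fin (n + 2) → ℝ) :
    ∃ x : EuclideanSpace ℝ (Fin (n + 1)), height x = u + Function.const _ (-u 0) := by
  refine ⟨WithLp.toLp 2 fun i => u i.succ - u 0, ?_⟩
  funext i
  cases i using Fin.cases <;> simp [height, sub_eq_add_neg]

theorem exists_profile_height_eq {u : Fin (n + 2) → ℝ} (hu : u ≠ 0) {i j : Fin (n + 2)}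
    (hi : 0 ≤ u i) (hj : u j ≤ 0) : ∃ x : EuclideanSpace ℝ (Fin (n + 1)), x ≠ 0 ∧
      ∃ s ∈ Set.Icc (0 : ℝ) 1, profile (height x) s = u := by
  obtain ⟨s, hs, hsu⟩ := exists_profile_eq_self hu hi hj
  obtain ⟨x, hx⟩ := exists_height_eq_add_const u
  have hxu : profile (height x) s = u := by rw [hx, profile_add_const, hsu]
  refine ⟨x, ?_, s, hs, hxu⟩
  rintro rfl
  rw [← zero_smul ℝ 0, height_smul, profile_smul le_rfl, zero_smul] at hxu
  exact hu hxu.symm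

theorem sum_abs_profile_pos {x : EuclideanSpace ℝ (Fin (n + 1))} (hx : x ≠ 0) (s : ℝ) :
    0 < ∑ i, |profile (height x) s i| := by
  obtain ⟨j, hj⟩ := exists_height_ne hx
  obtain ⟨k, hk⟩ := exists_profile_eq_mul (height x) s
  obtain ⟨l, hl⟩ := exists_profile_eq_neg_mul (height x) s
  have hspread := spread_pos hj
  refine (Finset.sum_nonneg fun i _ => abs_nonneg _).lt_of_ne' fun h => hspread.ne' ?_
  have hzero (i) : profile (height x) s i = 0 := abs_eq_zero.1
    ((Finset.sum_eq_zero_iff_of_nonneg fun i _ => abs_nonneg _).1 h i (Finset.mem_univ i))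
  rw [hzero] at hk hl
  linarith

/-- The profile of a point of the sphere, normalized in the `ℓ¹`-norm. -/
noncomputable def unitProfile (p : UnitSphere n × unitInterval) : Fin (n + 2) → ℝ :=
  (∑ i, |profile (height p.1.1) p.2 i|)⁻¹ • profile (height p.1.1) p.2

theorem sum_abs_profile_unitSphere_pos (p : UnitSphere n × unitInterval) :
    0 < ∑ i, |profile (height p.1.1) p.2 i| :=
  sum_abs_profile_pos (ne_zero_of_mem_unit_sphere p.1) p.2

theorem continuous_unitProfile : Continuous (unitProfile (n := n)) := by
  have hprofile : Continuous fun p : UnitSphere n × unitInterval => profile (height p.1.1) p.2 :=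
    continuous_profile.comp ((continuous_height.comp (continuous_subtype_val.comp
      continuous_fst)).prodMk (continuous_subtype_val.comp continuous_snd))
  refine Continuous.smul (Continuous.inv₀ ?_ fun p => (sum_abs_profile_unitSphere_pos p).ne')
    hprofile
  exact continuous_finsetSum _ fun i _ => ((continuous_apply i).comp hprofile).abs

theorem unitProfile_neg_symm (x : UnitSphere n) (s : unitInterval) :
    unitProfile (-x, unitInterval.symm s) = -unitProfile (x, s) := by
  simp only [unitProfile, coe_neg_sphere, height_neg, unitInterval.coe_symm_eq, profile_neg,
    Pi.neg_apply, abs_neg, smul_neg]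

theorem nonneg_unitProfile_iff {p : UnitSphere n × unitInterval} :
    0 ≤ unitProfile p ↔ p.2 = 1 := by
  obtain ⟨j, hj⟩ := exists_height_ne (ne_zero_of_mem_unit_sphere p.1)
  rw [unitProfile,
    smul_nonneg_iff_nonneg_of_pos_left (inv_pos.2 (sum_abs_profile_unitSphere_pos p)),
    profile_nonneg_iff hj, Subtype.ext_iff]
  exact ⟨fun h => p.2.2.2.antisymm h, fun h => h.ge⟩

theorem unitProfile_injective : Function.Injective (unitProfile (n := n)) := by
  rintro ⟨x, s⟩ ⟨x', s'⟩ h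
  set c := ∑ i, |profile (height x.1) s i|
  set c' := ∑ i, |profile (height x'.1) s' i|
  have hcpos : 0 < c := sum_abs_profile_unitSphere_pos (x, s)
  have hcpos' : 0 < c' := sum_abs_profile_unitSphere_pos (x', s')
  have hprofile : profile (height (c⁻¹ • x.1)) s = profile (height (c'⁻¹ • x'.1)) s' := by
    rw [height_smul, height_smul, profile_smul (inv_nonneg.2 hcpos.le),
      profile_smul (inv_nonneg.2 hcpos'.le)]
    exact h
  obtain ⟨j, hj⟩ := exists_height_ne
    (smul_ne_zero (inv_ne_zero hcpos.ne') (ne_zero_of_mem_unit_sphere x))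
  obtain ⟨hheight, hs⟩ := eq_of_profile_eq hprofile rfl hj
  have hx := height_injective hheight
  have hcc' : c⁻¹ = c'⁻¹ := by
    simpa [norm_smul, abs_of_pos hcpos, abs_of_pos hcpos'] using congrArg norm hx
  rw [hcc'] at hx
  exact Prod.ext (Subtype.ext (smul_right_injective _ (inv_ne_zero hcpos'.ne') hx)) (Subtype.ext hs)

theorem sum_abs_inv_smul {ι : Type*} [Fintype ι] {v : ι → ℝ} (hv : 0 < ∑ i, |v i|) :
    ∑ i, |((∑ i, |v i|)⁻¹ • v) i| = 1 := by
  simp only [Pi.smul_apply, smul_eq_mul, abs_mul, abs_inv, abs_of_pos hv, ← Finset.mul_sum]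
  exact inv_mul_cancel₀ hv.ne'

theorem mem_range_unitProfile {u : Fin (n + 2) → ℝ} :
    u ∈ Set.range unitProfile ↔ ∑ i, |u i| = 1 ∧ (∃ i, 0 ≤ u i) ∧ ∃ i, u i ≤ 0 := by
  constructor
  · rintro ⟨p, rfl⟩
    have hc := inv_nonneg.2 (sum_abs_profile_unitSphere_pos p).le
    refine ⟨sum_abs_inv_smul (sum_abs_profile_unitSphere_pos p), ?_, ?_⟩
    · obtain ⟨i, hi⟩ := exists_profile_eq_mul (height p.1.1) p.2
      refine ⟨i, mul_nonneg hc ?_⟩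
      rw [hi]
      exact mul_nonneg p.2.2.1 (spread_nonneg _)
    · obtain ⟨i, hi⟩ := exists_profile_eq_neg_mul (height p.1.1) p.2
      refine ⟨i, mul_nonpos_of_nonneg_of_nonpos hc ?_⟩
      rw [hi]
      exact neg_nonpos.2 (mul_nonneg (sub_nonneg.2 p.2.2.2) (spread_nonneg _))
  · rintro ⟨hu, ⟨i, hi⟩, j, hj⟩
    obtain ⟨x, hx0, s, hs, hxu⟩ :=
      exists_profile_height_eq (fun h => by simp [h] at hu : u ≠ 0) hi hj
    have hnorm : 0 < ‖x‖⁻¹ := inv_pos.2 (norm_pos_iff.2 hx0)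
    refine ⟨(⟨‖x‖⁻¹ • x, by simp [norm_smul, hx0]⟩, ⟨s, hs⟩), ?_⟩
    simp only [unitProfile, height_smul, profile_smul hnorm.le, hxu, Pi.smul_apply, smul_eq_mul,
      abs_mul, abs_of_pos hnorm, ← Finset.mul_sum, hu, mul_one, smul_smul,
      inv_mul_cancel₀ hnorm.ne', one_smul]

end SphereProfiles

section Gluings

variable {A B X Y : Type*} [TopologicalSpace A] [TopologicalSpace B] [TopologicalSpace X]
  [TopologicalSpace Y] {r : A → A → Prop} {q : A → X}

/-- The map `q` exhibits `X` as the quotient of `A` that identifies `a` with `b` whenever `r a b`,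
and no further points. -/
structure IsGluing (r : A → A → Prop) (q : A → X) : Prop where
  isQuotientMap : Topology.IsQuotientMap q
  eq_iff : ∀ a b, q a = q b ↔ a = b ∨ r a b ∨ r b a

theorem isGluing_quotMk (hl : Relator.LeftUnique r) (hr : Relator.RightUnique r)
    (hrr : ∀ a b c, r a b → ¬ r b c) : IsGluing r (Quot.mk r) where
  isQuotientMap := isQuotientMap_quot_mk
  eq_iff a b := by
    refine ⟨fun h => ?_, ?_⟩
    · replace h := Quot.eqvGen_exact h
      induction h with
      | rel a b h => exact .inr (.inl h)
      | refl a => exact .inl rfl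
      | symm a b _ ih => tauto
      | trans a b c _ _ hab hbc =>
        rcases hab with rfl | hab | hab
        · exact hbc
        · rcases hbc with rfl | hbc | hbc
          exacts [.inr (.inl hab), (hrr _ _ _ hab hbc).elim, .inl (hl hab hbc)]
        · rcases hbc with rfl | hbc | hbc
          exacts [.inr (.inr hab), .inl (hr hab hbc), (hrr _ _ _ hbc hab).elim]
    · rintro (rfl | h | h)
      exacts [rfl, Quot.sound h, (Quot.sound h).symm]

namespace IsGluing

theorem comp_homeomorph (hq : IsGluing r q) {r' : B → B → Prop} (e : B ≃ₜ A)
    (he : ∀ a b, r' a b ↔ r (e a) (e b)) : IsGluing r' (q ∘ e) where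
  isQuotientMap := hq.isQuotientMap.comp e.isQuotientMap
  eq_iff a b := by
    rw [Function.comp_apply, Function.comp_apply, hq.eq_iff, he, he, e.injective.eq_iff]

theorem nonempty_homeomorph (hq : IsGluing r q) {q' : A → Y} (hq' : IsGluing r q') :
    Nonempty (X ≃ₜ Y) := by
  have hker : Setoid.ker q = Setoid.ker q' :=
    Setoid.ext fun a b => (hq.eq_iff a b).trans (hq'.eq_iff a b).symm
  have eY : Nonempty (Quotient (Setoid.ker q) ≃ₜ Y) := by
    rw [hker]
    exact ⟨Topology.IsQuotientMap.homeomorph (f := ⟨q', hq'.isQuotientMap.continuous⟩)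
      hq'.isQuotientMap⟩
  exact eY.map (Topology.IsQuotientMap.homeomorph (f := ⟨q, hq.isQuotientMap.continuous⟩)
    hq.isQuotientMap).symm.trans

theorem exists_comp_eq {u : A → B} (hu : Topology.IsQuotientMap u)
    (hq : Topology.IsQuotientMap q) {s : B → B → Prop}
    (h : ∀ a b, q a = q b ↔ u a = u b ∨ s (u a) (u b) ∨ s (u b) (u a)) :
    ∃ π : B → X, IsGluing s π ∧ π ∘ u = q := by
  have hlift : q.FactorsThrough u := fun a b hab => (h a b).2 (.inl hab)
  let u' : C(A, B) := ⟨u, hu.continuous⟩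
  let π : C(B, X) := Topology.IsQuotientMap.lift (f := u') hu ⟨q, hq.continuous⟩ hlift
  have hπ : π ∘ u = q := congrArg DFunLike.coe
    (Topology.IsQuotientMap.lift_comp (f := u') hu ⟨q, hq.continuous⟩ hlift)
  refine ⟨π, ⟨.of_comp hu.continuous π.continuous (hπ ▸ hq), fun x y => ?_⟩, hπ⟩
  obtain ⟨a, rfl⟩ := hu.surjective x
  obtain ⟨b, rfl⟩ := hu.surjective y
  rw [← h, ← hπ, Function.comp_apply, Function.comp_apply]

theorem isOpenEmbedding_comp (hq : IsGluing r q) {j : B → A} (hj : Topology.IsOpenEmbedding j)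
    (hjr : ∀ b a, ¬ r (j b) a ∧ ¬ r a (j b)) : Topology.IsOpenEmbedding (q ∘ j) := by
  have hfiber (b a) (h : q (j b) = q a) : j b = a :=
    ((hq.eq_iff _ _).1 h).resolve_right (not_or.2 (hjr b a))
  refine .of_continuous_injective_isOpenMap (hq.isQuotientMap.continuous.comp hj.continuous)
    (fun b b' h => hj.injective (hfiber b _ h)) fun U hU => ?_
  have hpreimage : q ⁻¹' ((q ∘ j) '' U) = j '' U := by
    ext a
    exact ⟨fun ⟨b, hb, h⟩ => ⟨b, hb, hfiber b a h⟩, fun ⟨b, hb, h⟩ => ⟨b, hb, congrArg q h⟩⟩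
  rw [← hq.isQuotientMap.isOpen_preimage, hpreimage]
  exact hj.isOpenMap U hU

end IsGluing

end Gluings

section MappingTori

variable {S : Type*} {τ : S → S}

/-- The identification of `(x, 0)` with `(τ x, 1)` in `S × [0, 1]`, whose quotient is the mapping
torus of `τ`. -/
def MappingTorusRel (τ : S → S) (p q : S × unitInterval) : Prop := p.2 = 0 ∧ q = (τ p.1, 1)

theorem isGluing_quotMk_mappingTorusRel [TopologicalSpace S] (hτ : Function.Injective τ) :
    IsGluing (MappingTorusRel τ) (Quot.mk (MappingTorusRel τ)) := by
  refine isGluing_quotMk ?_ ?_ ?_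
  · rintro p p' q ⟨hp, hq⟩ ⟨hp', hq'⟩
    exact Prod.ext (hτ (congrArg Prod.fst (hq.symm.trans hq'))) (hp.trans hp'.symm)
  · rintro p q q' ⟨-, rfl⟩ ⟨-, rfl⟩
    rfl
  · rintro p q q' ⟨-, rfl⟩ ⟨h, -⟩
    exact one_ne_zero h

theorem circleExp_two_pi_mul_eq_iff {s t : unitInterval} :
    Circle.exp (2 * Real.pi * s) = Circle.exp (2 * Real.pi * t) ↔
      s = t ∨ (s = 0 ∧ t = 1) ∨ (t = 0 ∧ s = 1) := by
  constructor
  · intro h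
    obtain ⟨m, hm⟩ := Circle.exp_eq_exp.1 h
    have hst : (s : ℝ) = t + m := mul_left_cancel₀ Real.two_pi_pos.ne' (by linarith)
    have hm₁ : -2 < m := by exact_mod_cast (by linarith [s.2.1, t.2.2] : (-2 : ℝ) < m)
    have hm₂ : m < 2 := by exact_mod_cast (by linarith [s.2.2, t.2.1] : (m : ℝ) < 2)
    simp only [Subtype.ext_iff, Set.Icc.coe_zero, Set.Icc.coe_one]
    obtain rfl | rfl | rfl : m = -1 ∨ m = 0 ∨ m = 1 := by omega
    · push_cast at hst
      exact .inr (.inl ⟨by linarith [s.2.1, t.2.2], by linarith [s.2.1, t.2.2]⟩)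
    · exact .inl (by simpa using hst)
    · push_cast at hst
      exact .inr (.inr ⟨by linarith [s.2.2, t.2.1], by linarith [s.2.2, t.2.1]⟩)
  · rintro (rfl | ⟨rfl, rfl⟩ | ⟨rfl, rfl⟩) <;> simp

theorem exists_circleExp_two_pi_mul_eq (z : Circle) :
    ∃ t : unitInterval, Circle.exp (2 * Real.pi * t) = z := by
  obtain ⟨t, ht, hz⟩ := Circle.periodic_exp.exists_mem_Ico₀ Real.two_pi_pos (Complex.arg z)
  refine ⟨⟨t / (2 * Real.pi), div_nonneg ht.1 Real.two_pi_pos.le,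
    (div_le_one Real.two_pi_pos).2 ht.2.le⟩, ?_⟩
  rw [mul_div_cancel₀ _ Real.two_pi_pos.ne', ← hz, Circle.exp_arg]

theorem isGluing_prod_circle [TopologicalSpace S] [CompactSpace S] [T2Space S] :
    IsGluing (MappingTorusRel (id : S → S))
      (fun p : S × unitInterval => (p.1, Circle.exp (2 * Real.pi * p.2))) where
  isQuotientMap := by
    refine .of_surjective_continuous ?_ (by fun_prop)
    rintro ⟨x, z⟩
    obtain ⟨t, rfl⟩ := exists_circleExp_two_pi_mul_eq z
    exact ⟨(x, t), rfl⟩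
  eq_iff := by
    rintro ⟨x, s⟩ ⟨y, t⟩
    simp only [MappingTorusRel, Prod.mk.injEq, circleExp_two_pi_mul_eq_iff, id, eq_comm (a := y)]
    tauto

end MappingTori

section CyclicGluings

variable {S X : Type*} [TopologicalSpace S] [TopologicalSpace X] {σ : S ≃ₜ S} {m : ℕ}
  {q : (S × unitInterval) × Fin (m + 1) → X}

/-- The cyclic identification of `m + 1` cylinders over `S`: the end of each one is attached to the
beginning of the next one by `σ`. -/
def CyclicRel (σ : S ≃ₜ S) (a b : (S × unitInterval) × Fin (m + 1)) : Prop :=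
  a.1.2 = 1 ∧ b = ((σ a.1.1, 0), a.2 + 1)

/-- The point `s` of the `k`-th of `m + 1` consecutive subintervals of `[0, 1]`. -/
noncomputable def subintervalPoint (s : unitInterval) (k : Fin (m + 1)) : unitInterval :=
  ⟨((k : ℕ) + s) / (m + 1), div_nonneg (add_nonneg (Nat.cast_nonneg _) s.2.1) (by positivity), by
    have hk : ((k : ℕ) : ℝ) ≤ m := by exact_mod_cast Fin.is_le k
    rw [div_le_one (by positivity)]
    linarith [s.2.2]⟩

theorem subintervalPoint_eq_iff {s t : unitInterval} {k l : Fin (m + 1)} :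
    subintervalPoint s k = subintervalPoint t l ↔
      ((k : ℕ) : ℝ) + s = (l : ℕ) + t := by
  rw [Subtype.ext_iff]
  exact div_left_inj' (by positivity)

theorem coe_add_eq_coe_add_iff {s t : unitInterval} {k l : ℕ} : (k : ℝ) + s = l + t ↔
    (k = l ∧ s = t) ∨ (l = k + 1 ∧ s = 1 ∧ t = 0) ∨ (k = l + 1 ∧ t = 1 ∧ s = 0) := by
  simp only [Subtype.ext_iff, Set.Icc.coe_zero, Set.Icc.coe_one]
  constructor
  · intro h
    have hkl : k < l + 2 := by exact_mod_cast (by linarith [s.2.1, t.2.2] : (k : ℝ) < l + 2)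
    have hlk : l < k + 2 := by exact_mod_cast (by linarith [t.2.1, s.2.2] : (l : ℝ) < k + 2)
    obtain rfl | rfl | rfl : k = l ∨ l = k + 1 ∨ k = l + 1 := by omega
    · exact .inl ⟨rfl, add_left_cancel h⟩
    · push_cast at h
      exact .inr (.inl ⟨rfl, by linarith [s.2.2, t.2.1], by linarith [s.2.2, t.2.1]⟩)
    · push_cast at h
      exact .inr (.inr ⟨rfl, by linarith [t.2.2, s.2.1], by linarith [t.2.2, s.2.1]⟩)
  · rintro (⟨rfl, h⟩ | ⟨rfl, hs, ht⟩ | ⟨rfl, ht, hs⟩)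
    · rw [h]
    · rw [hs, ht]
      push_cast
      ring
    · rw [hs, ht]
      push_cast
      ring

theorem exists_subintervalPoint_eq (m : ℕ) (t : unitInterval) :
    ∃ s, ∃ k : Fin (m + 1), subintervalPoint s k = t := by
  have hm : (0 : ℝ) < m + 1 := by positivity
  rcases eq_or_ne t 1 with rfl | ht
  · exact ⟨1, Fin.last m, Subtype.ext (div_self hm.ne')⟩
  have htm : 0 ≤ (m + 1) * (t : ℝ) := mul_nonneg hm.le t.2.1
  have hfloor : ⌊(m + 1) * (t : ℝ)⌋₊ < m + 1 := by
    rw [Nat.floor_lt htm]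
    push_cast
    exact mul_lt_of_lt_one_right hm (unitInterval.lt_one_iff_ne_one.2 ht)
  refine ⟨⟨(m + 1) * t - ⌊(m + 1) * (t : ℝ)⌋₊, sub_nonneg.2 (Nat.floor_le htm), ?_⟩,
    ⟨_, hfloor⟩, Subtype.ext ?_⟩
  · linarith [Nat.lt_floor_add_one ((m + 1) * (t : ℝ))]
  · simp only [subintervalPoint, add_sub_cancel]
    exact mul_div_cancel_left₀ _ hm.ne'

theorem subintervalPoint_eq_zero_iff {s : unitInterval} {k : Fin (m + 1)} :
    subintervalPoint s k = 0 ↔ s = 0 ∧ k = 0 := by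
  have hzero : subintervalPoint 0 (0 : Fin (m + 1)) = 0 := by
    simp [subintervalPoint]
  conv_lhs => rw [← hzero]
  rw [subintervalPoint_eq_iff, coe_add_eq_coe_add_iff, Fin.ext_iff, Fin.val_zero]
  simp [and_comm]

theorem subintervalPoint_eq_one_iff {s : unitInterval} {k : Fin (m + 1)} :
    subintervalPoint s k = 1 ↔ s = 1 ∧ k = Fin.last m := by
  have hone : subintervalPoint 1 (Fin.last m) = 1 :=
    Subtype.ext (div_self m.cast_add_one_ne_zero)
  have hk := k.is_le
  conv_lhs => rw [← hone]
  rw [subintervalPoint_eq_iff, coe_add_eq_coe_add_iff, Fin.ext_iff, Fin.val_last]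
  simp only [one_ne_zero, and_false, false_or, true_and, and_comm (a := (k : ℕ) = m),
    or_iff_left_iff_imp]
  exact fun h => by omega

/-- The map that places the cylinders one after the other. -/
noncomputable def unroll (σ : S ≃ₜ S) (a : (S × unitInterval) × Fin (m + 1)) : S × unitInterval :=
  ((σ ^ (a.2 : ℕ))⁻¹ a.1.1, subintervalPoint a.1.2 a.2)

theorem continuous_unroll : Continuous (unroll (m := m) σ) := by
  refine continuous_prod_of_discrete_right.2 fun k => Continuous.prodMk ?_ ?_
  · exact ((σ ^ (k : ℕ))⁻¹).continuous.comp continuous_fst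
  · unfold subintervalPoint
    fun_prop

theorem unroll_surjective : Function.Surjective (unroll (m := m) σ) := by
  rintro ⟨y, t⟩
  obtain ⟨s, k, rfl⟩ := exists_subintervalPoint_eq m t
  exact ⟨(((σ ^ (k : ℕ)) y, s), k), Prod.ext ((σ ^ (k : ℕ)).symm_apply_apply y) rfl⟩

theorem inv_pow_apply_eq_inv_pow_succ_apply_iff {k : ℕ} {x y : S} :
    (σ ^ k)⁻¹ x = (σ ^ (k + 1))⁻¹ y ↔ y = σ x := by
  rw [pow_succ', mul_inv_rev, Homeomorph.mul_apply, EmbeddingLike.apply_eq_iff_eq,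
    Homeomorph.inv_apply, Homeomorph.eq_symm_apply, eq_comm]

theorem unroll_eq_iff {a b : (S × unitInterval) × Fin (m + 1)} : unroll σ a = unroll σ b ↔
    a = b ∨ (CyclicRel σ a b ∧ a.2 ≠ Fin.last m) ∨ (CyclicRel σ b a ∧ b.2 ≠ Fin.last m) := by
  have hsucc {k l : Fin (m + 1)} (hk : k ≠ Fin.last m) :
      l = k + 1 ↔ (l : ℕ) = k + 1 := by
    rw [Fin.ext_iff, Fin.val_add_one_of_lt (Fin.lt_last_iff_ne_last.2 hk)]
  obtain ⟨⟨x, s⟩, k⟩ := a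
  obtain ⟨⟨y, t⟩, l⟩ := b
  simp only [unroll, Prod.mk.injEq, CyclicRel, subintervalPoint_eq_iff, coe_add_eq_coe_add_iff]
  constructor
  · rintro ⟨hxy, ⟨hkl, rfl⟩ | ⟨hl, rfl, rfl⟩ | ⟨hk, rfl, rfl⟩⟩
    · rw [hkl, EmbeddingLike.apply_eq_iff_eq] at hxy
      exact .inl ⟨⟨hxy, rfl⟩, Fin.ext hkl⟩
    · have hlast : k ≠ Fin.last m := Fin.ne_last_of_lt (b := l) (Fin.lt_def.2 (by omega))
      rw [hl, inv_pow_apply_eq_inv_pow_succ_apply_iff] at hxy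
      exact .inr (.inl ⟨⟨rfl, ⟨hxy, rfl⟩, (hsucc hlast).2 hl⟩, hlast⟩)
    · have hlast : l ≠ Fin.last m := Fin.ne_last_of_lt (b := k) (Fin.lt_def.2 (by omega))
      rw [hk, eq_comm, inv_pow_apply_eq_inv_pow_succ_apply_iff] at hxy
      exact .inr (.inr ⟨⟨rfl, ⟨hxy, rfl⟩, (hsucc hlast).2 hk⟩, hlast⟩)
  · rintro (⟨⟨rfl, rfl⟩, rfl⟩ | ⟨⟨rfl, ⟨hy, rfl⟩, hl⟩, hlast⟩ | ⟨⟨rfl, ⟨hx, rfl⟩, hk⟩, hlast⟩)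
    · exact ⟨rfl, .inl ⟨rfl, rfl⟩⟩
    · rw [hsucc hlast] at hl
      exact ⟨hl ▸ inv_pow_apply_eq_inv_pow_succ_apply_iff.2 hy, .inr (.inl ⟨hl, rfl, rfl⟩)⟩
    · rw [hsucc hlast] at hk
      exact ⟨hk ▸ (inv_pow_apply_eq_inv_pow_succ_apply_iff.2 hx).symm,
        .inr (.inr ⟨hk, rfl, rfl⟩)⟩

theorem mappingTorusRel_unroll_iff {a b : (S × unitInterval) × Fin (m + 1)} :
    MappingTorusRel ⇑(σ ^ (m + 1))⁻¹ (unroll σ a) (unroll σ b) ↔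
      CyclicRel σ b a ∧ b.2 = Fin.last m := by
  obtain ⟨⟨x, s⟩, k⟩ := a
  obtain ⟨⟨y, t⟩, l⟩ := b
  simp only [unroll, MappingTorusRel, CyclicRel, Prod.mk.injEq, subintervalPoint_eq_zero_iff,
    subintervalPoint_eq_one_iff]
  constructor
  · rintro ⟨⟨rfl, rfl⟩, hxy, rfl, rfl⟩
    exact ⟨⟨rfl, ⟨inv_pow_apply_eq_inv_pow_succ_apply_iff.1 hxy, rfl⟩, (Fin.last_add_one m).symm⟩,
      rfl⟩
  · rintro ⟨⟨rfl, ⟨hx, rfl⟩, hk⟩, rfl⟩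
    rw [Fin.last_add_one] at hk
    subst hk
    exact ⟨⟨rfl, rfl⟩, inv_pow_apply_eq_inv_pow_succ_apply_iff.2 hx, rfl, rfl⟩

theorem IsGluing.exists_isGluing_mappingTorusRel [CompactSpace S] [T2Space S]
    (hq : IsGluing (CyclicRel σ) q) :
    ∃ π, IsGluing (MappingTorusRel ⇑(σ ^ (m + 1))⁻¹) π ∧ π ∘ unroll σ = q := by
  refine IsGluing.exists_comp_eq (.of_surjective_continuous unroll_surjective continuous_unroll)
    hq.isQuotientMap fun a b => ?_
  rw [hq.eq_iff, unroll_eq_iff, mappingTorusRel_unroll_iff, mappingTorusRel_unroll_iff]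
  tauto

theorem IsGluing.comp_shift (hq : IsGluing (CyclicRel σ) q) (j : Fin (m + 1)) :
    IsGluing (CyclicRel σ) fun a => q (a.1, a.2 + j) := by
  refine hq.comp_homeomorph ((Homeomorph.refl _).prodCongr (Homeomorph.addRight j)) ?_
  rintro ⟨⟨x, s⟩, k⟩ ⟨⟨y, t⟩, l⟩
  simp [CyclicRel, add_right_comm _ j]

end CyclicGluings

section Charts

theorem IsGluing.isOpenEmbedding_mappingTorus {S N : Type*} [TopologicalSpace S]
    [TopologicalSpace N] {τ : S → S} {π : S × unitInterval → N}
    (hπ : IsGluing (MappingTorusRel τ) π) :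
    Topology.IsOpenEmbedding
      (π ∘ Prod.map id (Set.inclusion (Set.Ioo_subset_Icc_self (a := (0 : ℝ)) (b := 1)))) := by
  refine hπ.isOpenEmbedding_comp (.prodMap .id (.inclusion _ ?_)) fun p p' => ⟨?_, ?_⟩
  · exact isOpen_Ioo.preimage continuous_subtype_val
  · exact fun h => p.2.2.1.ne' (congrArg Subtype.val h.1)
  · exact fun h => p.2.2.2.ne (congrArg (fun p => (p.2 : ℝ)) h.2)

theorem IsGluing.exists_isOpenEmbedding {S X : Type*} [TopologicalSpace S] [CompactSpace S]
    [T2Space S] [TopologicalSpace X] {σ : S ≃ₜ S} {m : ℕ} (hm : 2 ≤ m)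
    {q : (S × unitInterval) × Fin (m + 1) → X} (hq : IsGluing (CyclicRel σ) q) (w : X) :
    ∃ j : S × Set.Ioo (0 : ℝ) 1 → X, Topology.IsOpenEmbedding j ∧ w ∈ Set.range j := by
  obtain ⟨⟨⟨x, s⟩, k⟩, rfl⟩ := hq.isQuotientMap.surjective w
  obtain ⟨π, hπ, hπq⟩ := (hq.comp_shift (k - 1)).exists_isGluing_mappingTorusRel
  have hw : π (unroll σ ((x, s), (1 : Fin (m + 1)))) = q ((x, s), k) := by
    simpa using congrFun hπq ((x, s), 1)
  have hone : ((1 : Fin (m + 1)) : ℕ) = 1 := by rw [Fin.val_one', Nat.mod_eq_of_lt (by omega)]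
  have hzero : (1 : Fin (m + 1)) ≠ 0 := fun h => by simp [h] at hone
  have hlast : (1 : Fin (m + 1)) ≠ Fin.last m := fun h => by
    rw [h, Fin.val_last] at hone
    omega
  refine ⟨_, hπ.isOpenEmbedding_mappingTorus,
    ((unroll σ ((x, s), (1 : Fin (m + 1)))).1,
      ⟨(unroll σ ((x, s), (1 : Fin (m + 1)))).2, ?_, ?_⟩), hw⟩
  · exact unitInterval.pos_iff_ne_zero.2 fun h => hzero (subintervalPoint_eq_zero_iff.1 h).2
  · exact unitInterval.lt_one_iff_ne_one.2 fun h => hlast (subintervalPoint_eq_one_iff.1 h).2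

theorem nonempty_chartedSpace_of_isOpenEmbedding {H M X : Type*} [TopologicalSpace H]
    [TopologicalSpace M] [ChartedSpace H M] [TopologicalSpace X]
    (h : ∀ w : X, ∃ j : M → X, Topology.IsOpenEmbedding j ∧ w ∈ Set.range j) :
    Nonempty (ChartedSpace H X) := by
  have hchart (w : X) : ∃ e : OpenPartialHomeomorph X H, w ∈ e.source := by
    obtain ⟨j, hj, p, rfl⟩ := h w
    have : Nonempty M := ⟨p⟩
    exact ⟨(hj.toOpenPartialHomeomorph j).symm.trans (chartAt H p),
      by simp [hj.toOpenPartialHomeomorph_left_inv]⟩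
  choose e he using hchart
  exact ⟨⟨Set.range e, e, he, fun w => ⟨w, rfl⟩⟩⟩

theorem nonempty_chartedSpace_prod_Ioo {S : Type*} [TopologicalSpace S] {n : ℕ}
    [ChartedSpace (EuclideanSpace ℝ (Fin n)) S] (a b : ℝ) :
    Nonempty (ChartedSpace (EuclideanSpace ℝ (Fin (n + 1))) (S × Set.Ioo a b)) := by
  have e : (EuclideanSpace ℝ (Fin n) × ℝ) ≃L[ℝ] EuclideanSpace ℝ (Fin (n + 1)) :=
    ContinuousLinearEquiv.ofFinrankEq (by simp)
  let _ : ChartedSpace (EuclideanSpace ℝ (Fin (n + 1))) (ModelProd (EuclideanSpace ℝ (Fin n)) ℝ) :=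
    e.toHomeomorph.isOpenEmbedding.singletonChartedSpace
  let _ : ChartedSpace ℝ (Set.Ioo a b) :=
    inferInstanceAs (ChartedSpace ℝ (⟨Set.Ioo a b, isOpen_Ioo⟩ : TopologicalSpace.Opens ℝ))
  exact ⟨.comp _ (ModelProd (EuclideanSpace ℝ (Fin n)) ℝ) _⟩

end Charts

section CylinderMap

variable {n : ℕ}

theorem ne_succ : ∀ k : Fin 3, k ≠ k + 1 ∧ k + 1 ≠ k + 1 + 1 ∧ k ≠ k + 1 + 1 := by
  decide

theorem mem_realization_BM {w : Vert₃ (n + 2) → ℝ} : w ∈ realization (BM (n + 2)) ↔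
    ∃ k p, crossPoint (layersBM (n + 2) k) (layersBM (n + 2) (k + 1)) (unitProfile p) = w := by
  rw [BM_eq, isLayering_layersBM.mem_realization]
  · constructor
    · rintro ⟨_, ⟨k, rfl⟩, u, hu, hpos, hneg, rfl⟩
      obtain ⟨p, rfl⟩ := mem_range_unitProfile.2 ⟨hu, hpos trivial, hneg trivial⟩
      exact ⟨k, p, rfl⟩
    · rintro ⟨k, p, rfl⟩
      obtain ⟨hu, hpos, hneg⟩ := mem_range_unitProfile.1 (Set.mem_range_self p)
      exact ⟨_, ⟨k, rfl⟩, _, hu, fun _ => hpos, fun _ => hneg, rfl⟩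
  · rintro _ ⟨_, rfl⟩
    exact (ne_succ _).1

/-- The parametrization of the realization of `BM (n + 2)` by three cylinders over `S^n`, one for
each of the cross-polytopes with two facets removed. -/
noncomputable def cylinderMap (a : (UnitSphere n × unitInterval) × Fin 3) :
    realization (BM (n + 2)) :=
  ⟨crossPoint (layersBM (n + 2) a.2) (layersBM (n + 2) (a.2 + 1)) (unitProfile a.1),
    mem_realization_BM.2 ⟨a.2, a.1, rfl⟩⟩

theorem cylinderMap_surjective : Function.Surjective (cylinderMap (n := n)) := by
  rintro ⟨w, hw⟩
  obtain ⟨k, p, rfl⟩ := mem_realization_BM.1 hw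
  exact ⟨(p, k), rfl⟩

theorem continuous_cylinderMap : Continuous (cylinderMap (n := n)) :=
  continuous_prod_of_discrete_right.2 fun _ =>
    ((continuous_crossPoint _ _).comp continuous_unitProfile).subtype_mk _

theorem cylinderMap_eq_succ_iff {p p' : UnitSphere n × unitInterval} {k : Fin 3} :
    cylinderMap (p, k) = cylinderMap (p', k + 1) ↔ p.2 = 1 ∧ p' = (-p.1, 0) := by
  rw [Subtype.ext_iff]
  have hneg (hp : p.2 = 1) : -unitProfile p = unitProfile (-p.1, 0) := by
    rw [← Prod.mk.eta (p := p), hp, ← unitProfile_neg_symm, unitInterval.symm_one]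
  constructor
  · intro h
    obtain ⟨hp, hp'⟩ := isLayering_layersBM.eq_neg_of_crossPoint_eq
      (ne_succ k).1 (ne_succ k).2.1 (ne_succ k).2.2 h
    rw [nonneg_unitProfile_iff] at hp
    rw [hneg hp] at hp'
    exact ⟨hp, unitProfile_injective hp'⟩
  · rintro ⟨hp, rfl⟩
    exact (crossPoint_eq_crossPoint_neg (nonneg_unitProfile_iff.2 hp) _ _ _).trans
      (congrArg _ (hneg hp))

theorem isGluing_cylinderMap :
    IsGluing (CyclicRel (Homeomorph.neg (UnitSphere n))) (cylinderMap (n := n)) where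
  isQuotientMap := .of_surjective_continuous cylinderMap_surjective continuous_cylinderMap
  eq_iff := by
    rintro ⟨p, k⟩ ⟨p', l⟩
    obtain rfl | rfl | rfl : k = l ∨ l = k + 1 ∨ k = l + 1 := by decide +revert
    · rw [Subtype.ext_iff]
      refine ((isLayering_layersBM.crossPoint_injective (ne_succ k).1).comp
        unitProfile_injective).eq_iff.trans ?_
      simp [CyclicRel]
    · simp [cylinderMap_eq_succ_iff, CyclicRel, ne_succ k]
    · rw [eq_comm, cylinderMap_eq_succ_iff]
      simp [CyclicRel, ne_succ l]

theorem isSimplicialManifold_BM : IsSimplicialManifold (n + 1) (BM (n + 2)) where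
  t2 := inferInstance
  secondCountable := inferInstance
  locallyEuclidean := by
    have : Fact (Module.finrank ℝ (EuclideanSpace ℝ (Fin (n + 1))) = n + 1) := ⟨by simp⟩
    obtain ⟨_⟩ := nonempty_chartedSpace_prod_Ioo (S := UnitSphere n) (n := n) 0 1
    exact nonempty_chartedSpace_of_isOpenEmbedding
      (isGluing_cylinderMap.exists_isOpenEmbedding le_rfl)

end CylinderMap

section Rotations

open scoped RealInnerProductSpace

variable {E : Type*} [NormedAddCommGroup E] [InnerProductSpace ℝ E] {J : E →L[ℝ] E}

/-- `J` is skew-symmetric and its square is minus the projection to its range, so that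
`exp (θ J)` rotates the range of `J` by the angle `θ` and fixes the kernel of `J`. -/
structure IsRotationGenerator (J : E →L[ℝ] E) : Prop where
  inner_left : ∀ x y, ⟪J x, y⟫ = -⟪x, J y⟫
  apply_apply_apply : ∀ x, J (J (J x)) = -J x

/-- The rotation `exp (θ J)`, given by Rodrigues' formula. -/
noncomputable def rotation (J : E →L[ℝ] E) (θ : ℝ) (x : E) : E :=
  x + Real.sin θ • J x + (1 - Real.cos θ) • J (J x)

theorem rotation_zero (J : E →L[ℝ] E) (x : E) : rotation J 0 x = x := by
  simp [rotation]

theorem rotation_pi (J : E →L[ℝ] E) (x : E) :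
    rotation J Real.pi x = x + (2 : ℝ) • J (J x) := by
  norm_num [rotation]

theorem continuous_rotation (J : E →L[ℝ] E) : Continuous fun p : ℝ × E => rotation J p.1 p.2 := by
  unfold rotation
  fun_prop

namespace IsRotationGenerator

theorem rotation_neg_rotation (hJ : IsRotationGenerator J) (θ : ℝ) (x : E) :
    rotation J (-θ) (rotation J θ x) = x := by
  simp only [rotation, map_add, map_smul, hJ.apply_apply_apply, map_neg, Real.sin_neg,
    Real.cos_neg]
  linear_combination (norm := module) (Real.sin_sq_add_cos_sq θ).symm • J (J x)

theorem norm_rotation (hJ : IsRotationGenerator J) (θ : ℝ) (x : E) : ‖rotation J θ x‖ = ‖x‖ := by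
  have hinner : ⟪x, J x⟫ = 0 := by
    linarith [hJ.inner_left x x, real_inner_comm x (J x)]
  rw [← sq_eq_sq₀ (norm_nonneg _) (norm_nonneg _), ← real_inner_self_eq_norm_sq,
    ← real_inner_self_eq_norm_sq]
  simp only [rotation, inner_add_left, inner_add_right, real_inner_smul_left,
    real_inner_smul_right, hJ.inner_left, hJ.apply_apply_apply, map_neg, inner_neg_right,
    hinner]
  linear_combination -⟪x, J (J x)⟫ * Real.sin_sq_add_cos_sq θ

/-- The rotation by the angle `θ` as a permutation of the unit sphere. -/
noncomputable def sphereRotation (hJ : IsRotationGenerator J) (θ : ℝ) :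
    Metric.sphere (0 : E) 1 ≃ Metric.sphere (0 : E) 1 where
  toFun x := ⟨rotation J θ x, by
    rw [mem_sphere_zero_iff_norm, hJ.norm_rotation, norm_eq_of_mem_sphere]⟩
  invFun x := ⟨rotation J (-θ) x, by
    rw [mem_sphere_zero_iff_norm, hJ.norm_rotation, norm_eq_of_mem_sphere]⟩
  left_inv x := Subtype.ext (hJ.rotation_neg_rotation θ x)
  right_inv x := Subtype.ext (by simpa using hJ.rotation_neg_rotation (-θ) x)

theorem coe_sphereRotation (hJ : IsRotationGenerator J) (θ : ℝ) (x : Metric.sphere (0 : E) 1) :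
    (hJ.sphereRotation θ x : E) = rotation J θ x := rfl

/-- The homeomorphism of the cylinder over the unit sphere that rotates it by the angle `π t` at the
height `t`. -/
noncomputable def twist (hJ : IsRotationGenerator J) :
    Metric.sphere (0 : E) 1 × unitInterval ≃ₜ Metric.sphere (0 : E) 1 × unitInterval where
  toFun p := (hJ.sphereRotation (Real.pi * p.2) p.1, p.2)
  invFun p := ((hJ.sphereRotation (Real.pi * p.2)).symm p.1, p.2)
  left_inv p := by simp
  right_inv p := by simp
  continuous_toFun := .prodMk (.subtype_mk ((continuous_rotation J).comp
    (f := fun p : Metric.sphere (0 : E) 1 × unitInterval => (Real.pi * (p.2 : ℝ), (p.1 : E)))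
    (by fun_prop)) _) continuous_snd
  continuous_invFun := .prodMk (.subtype_mk ((continuous_rotation J).comp
    (f := fun p : Metric.sphere (0 : E) 1 × unitInterval => (-(Real.pi * (p.2 : ℝ)), (p.1 : E)))
    (by fun_prop)) _) continuous_snd

theorem isGluing_comp_twist (hJ : IsRotationGenerator J) {N : Type*} [TopologicalSpace N]
    {τ : Metric.sphere (0 : E) 1 → Metric.sphere (0 : E) 1}
    {q : Metric.sphere (0 : E) 1 × unitInterval → N}
    (hq : IsGluing (MappingTorusRel fun x => hJ.sphereRotation Real.pi (τ x)) q) :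
    IsGluing (MappingTorusRel τ) (q ∘ hJ.twist) := by
  have hzero (x) : hJ.twist (x, 0) = (x, 0) :=
    Prod.ext (Subtype.ext (by simp [twist, coe_sphereRotation, rotation_zero])) rfl
  have hone (x) : hJ.twist (x, 1) = (hJ.sphereRotation Real.pi x, 1) := by
    simp [twist]
  refine hq.comp_homeomorph hJ.twist ?_
  rintro ⟨x, s⟩ p
  refine and_congr_right fun (hs : s = 0) => ?_
  rw [hs, hzero, ← hone, hJ.twist.injective.eq_iff]

end IsRotationGenerator

end Rotations

section PairedCoordinates

variable {m : ℕ} {p : Fin m → Fin m}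

/-- The sign of the coordinate `i` in its pair `{i, p i}`; it is `0` if `p i = i`. -/
noncomputable def pairSign (p : Fin m → Fin m) (i : Fin m) : ℝ := Real.sign ((p i : ℝ) - (i : ℝ))

theorem pairSign_apply (hp : Function.Involutive p) (i : Fin m) :
    pairSign p (p i) = -pairSign p i := by
  rw [pairSign, pairSign, hp, ← Real.sign_neg, neg_sub]

theorem pairSign_sq (p : Fin m → Fin m) (i : Fin m) :
    pairSign p i ^ 2 = if p i = i then 0 else 1 := by
  split_ifs with h
  · simp [pairSign, h]
  · have hne : (p i : ℝ) - (i : ℝ) ≠ 0 := by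
      simpa [sub_eq_zero, Fin.val_inj] using h
    rcases Real.sign_apply_eq_of_ne_zero _ hne with h | h <;> simp [pairSign, h]

/-- The infinitesimal rotation in the planes spanned by the coordinates `i` and `p i`. -/
noncomputable def pairGenerator (p : Fin m → Fin m) :
    EuclideanSpace ℝ (Fin m) →L[ℝ] EuclideanSpace ℝ (Fin m) :=
  LinearMap.toContinuousLinearMap
    { toFun x := WithLp.toLp 2 fun i => pairSign p i * x (p i)
      map_add' _ _ := PiLp.ext fun _ => mul_add _ _ _
      map_smul' _ _ := PiLp.ext fun _ => mul_left_comm _ _ _ }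

theorem pairGenerator_apply (p : Fin m → Fin m) (x : EuclideanSpace ℝ (Fin m)) (i : Fin m) :
    pairGenerator p x i = pairSign p i * x (p i) := rfl

theorem pairGenerator_pairGenerator_apply (hp : Function.Involutive p)
    (x : EuclideanSpace ℝ (Fin m)) (i : Fin m) :
    pairGenerator p (pairGenerator p x) i = if p i = i then 0 else -x i := by
  rw [pairGenerator_apply, pairGenerator_apply, pairSign_apply hp, hp i,
    show pairSign p i * (-pairSign p i * x i) = -(pairSign p i ^ 2 * x i) by ring, pairSign_sq]
  split_ifs <;> simp

theorem isRotationGenerator_pairGenerator (hp : Function.Involutive p) :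
    IsRotationGenerator (pairGenerator p) where
  inner_left x y := by
    simp only [PiLp.inner_apply, pairGenerator_apply, ← Finset.sum_neg_distrib]
    rw [← Equiv.sum_comp hp.toPerm]
    refine Finset.sum_congr rfl fun i _ => ?_
    simp [pairSign_apply hp, hp i]
    ring
  apply_apply_apply x := PiLp.ext fun i => by
    rw [pairGenerator_pairGenerator_apply hp, PiLp.neg_apply]
    split_ifs with h
    · simp [pairGenerator_apply, pairSign, h]
    · rfl

theorem rotation_pairGenerator_pi_apply (hp : Function.Involutive p)
    (x : EuclideanSpace ℝ (Fin m)) (i : Fin m) :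
    rotation (pairGenerator p) Real.pi x i = if p i = i then x i else -x i := by
  rw [rotation_pi, PiLp.add_apply, PiLp.smul_apply, pairGenerator_pairGenerator_apply hp]
  split_ifs
  · simp
  · rw [smul_eq_mul]
    ring

end PairedCoordinates

section HomeomorphismType

variable {n : ℕ}

theorem exists_isGluing_mappingTorusRel_neg (n : ℕ) :
    ∃ π : UnitSphere n × unitInterval → realization (BM (n + 2)),
      IsGluing (MappingTorusRel Neg.neg) π := by
  obtain ⟨π, hπ, -⟩ := (isGluing_cylinderMap (n := n)).exists_isGluing_mappingTorusRel
  have hneg : ⇑(Homeomorph.neg (UnitSphere n) ^ (2 + 1))⁻¹ = Neg.neg := by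
    funext x
    simp [pow_succ, Homeomorph.mul_apply]
  exact ⟨π, hneg ▸ hπ⟩

theorem nonempty_BM_homeomorph_of_isGluing {N : Type*} [TopologicalSpace N]
    {J : EuclideanSpace ℝ (Fin (n + 1)) →L[ℝ] EuclideanSpace ℝ (Fin (n + 1))}
    (hJ : IsRotationGenerator J) {q : UnitSphere n × unitInterval → N}
    (hq : IsGluing (MappingTorusRel fun x => hJ.sphereRotation Real.pi (-x)) q) :
    Nonempty (realization (BM (n + 2)) ≃ₜ N) := by
  obtain ⟨π, hπ⟩ := exists_isGluing_mappingTorusRel_neg n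
  exact hπ.nonempty_homeomorph (hJ.isGluing_comp_twist hq)

theorem sphereRotation_pi_neg_apply {p : Fin (n + 1) → Fin (n + 1)} (hp : Function.Involutive p)
    (x : UnitSphere n) (i : Fin (n + 1)) :
    ((isRotationGenerator_pairGenerator hp).sphereRotation Real.pi (-x)).1 i =
      if p i = i then -x.1 i else x.1 i := by
  rw [IsRotationGenerator.coe_sphereRotation, rotation_pairGenerator_pi_apply hp]
  split_ifs <;> simp

theorem nonempty_BM_homeomorph_prod_circle (hn : Odd n) :
    Nonempty (realization (BM (n + 2)) ≃ₜ UnitSphere n × Circle) := by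
  have hrev (i : Fin (n + 1)) : i.rev ≠ i := fun h => by
    rw [Fin.ext_iff, Fin.val_rev] at h
    grind
  have hid : (fun x : UnitSphere n => (isRotationGenerator_pairGenerator
      (p := Fin.rev (n := n + 1)) Fin.rev_involutive).sphereRotation Real.pi (-x)) = id := by
    funext x
    refine Subtype.ext (PiLp.ext fun i => ?_)
    rw [sphereRotation_pi_neg_apply Fin.rev_involutive, if_neg (hrev i), id]
  exact nonempty_BM_homeomorph_of_isGluing _ (hid ▸ isGluing_prod_circle)

theorem nonempty_BM_homeomorph_nonorientableSphereBundle (hn : Even n) :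
    Nonempty (realization (BM (n + 2)) ≃ₜ NonorientableSphereBundle n) := by
  have hfix (i : Fin (n + 1)) : -i = i ↔ i = 0 := by
    rcases eq_or_ne i 0 with rfl | hi
    · simp
    · refine iff_of_false (fun h => ?_) hi
      rw [Fin.ext_iff, Fin.val_neg, if_neg hi] at h
      grind
  have hneg : Function.Involutive (Neg.neg : Fin (n + 1) → Fin (n + 1)) := neg_neg
  have hJ := isRotationGenerator_pairGenerator hneg
  have hrel : (fun p q : UnitSphere n × unitInterval => p.2 = 0 ∧ q.2 = 1 ∧
      ∀ i, q.1.1 i = if i = 0 then -p.1.1 i else p.1.1 i) =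
      MappingTorusRel fun x => hJ.sphereRotation Real.pi (-x) := by
    funext p q
    simp only [MappingTorusRel, Prod.ext_iff, Subtype.ext_iff (a1 := q.1), PiLp.ext_iff,
      sphereRotation_pi_neg_apply hneg, hfix, and_comm (a := q.2 = 1)]
  unfold NonorientableSphereBundle
  rw [hrel]
  exact nonempty_BM_homeomorph_of_isGluing hJ (isGluing_quotMk_mappingTorusRel
    ((hJ.sphereRotation Real.pi).injective.comp neg_injective))

end HomeomorphismType

end BalancedManifold

theorem theorem6p3 (d : ℕ) (hd : 2 ≤ d) :
    -- `BM d` is built by two balanced connected sums and one balanced handle addition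
    IsBalancedConnectedSum d (crossPolytope d) (color₁ d) (crossPolytope d) (color₁ d)
        (facetY d) (glueY d) ∧
      IsBalancedConnectedSum d (sum₂ d) (color₂ d) (crossPolytope d) (color₁ d)
        (facetZ d) (glueZ d) ∧
      IsBalancedHandleAddition d (sum₃ d) (color₃ d) (facetX d) (glueX d) ∧
    -- it is a balanced simplicial manifold of dimension `d - 1` with `3 d` vertices
      IsBalanced d (BM d) (color₃ d) ∧
      IsSimplicialManifold (d - 1) (BM d) ∧
      (vertices (BM d)).ncard = 3 * d ∧
    -- its homeomorphism type
      (Odd d → Nonempty (realization (BM d) ≃ₜ UnitSphere (d - 2) × Circle)) ∧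
      (Even d → Nonempty (realization (BM d) ≃ₜ NonorientableSphereBundle (d - 2))) := by
  refine ⟨isBalancedConnectedSum_crossPolytope hd, isBalancedConnectedSum_sum₂ hd,
    isBalancedHandleAddition_sum₃ hd, isBalanced_BM hd, ?_, ncard_vertices_BM hd, ?_, ?_⟩ <;>
    obtain ⟨n, rfl⟩ := Nat.exists_eq_add_of_le' hd
  · exact isSimplicialManifold_BM
  · exact fun h => nonempty_BM_homeomorph_prod_circle ((Nat.odd_add.1 h).2 even_two)
  · exact fun h =>
      nonempty_BM_homeomorph_nonorientableSphereBundle ((Nat.even_add.1 h).2 even_two)
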